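/- Let $\sigma$ denote the arc length measure on the unit circle $\mathbb{S}^1\subset\mathbb{R}^2$. For a Lipschitz continuous function $h:\mathbb{S}^1\to\mathbb{C}$ put $$\|h\|_{\mathrm{Lip}}=\sup_{\omega\in\mathbb{S}^1}|h(\omega)|+\sup_{\omega\neq\omega'}\frac{|h(\omega)-h(\omega')|}{|\omega-\omega'|},$$ and let $h\sigma$ denote the complex Borel measure $E\mapsto\int_{\mathbb{S}^1\cap E}h\,\mathrm{d}\sigma$ on $\mathbb{R}^2$. **Proposition.** For every $\gamma>0$ there exist $\tau\in(0,1)$ and $C_0<\infty$, depending only on $\gamma$, with the following property. For all Lipschitz functions $h_1,h_2,h_3,h_4:\mathbb{S}^1\to\mathbb{C}$, the convolution measure $h_1\sigma\ast h_2\sigma\ast h_3\sigma\ast h_4\sigma$ is absolutely continuous with respect to Lebesgue measure on $\mathbb{R}^2$, and it has a density $G\in L^1(\mathbb{R}^2)$ such that the function $H_\gamma(x)=|x|^\gamma G(x)$ satisfies $$|H_\gamma(x)-H_\gamma(x')|\le C_0\Big(\prod_{j=1}^4\|h_j\|_{\mathrm{Lip}}\Big)|x-x'|^{\tau}\quad\text{for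 all }x,x'\in\mathbb{R}^2.$$ -/

import Mathlib

open MeasureTheory

noncomputable section

/-- The Euclidean plane `ℝ²`. -/
abbrev Plane : Type := EuclideanSpace ℝ (Fin 2)

/-- The unit circle `𝕊¹ ⊆ ℝ²`, with the distance `|ω - ω'|` inherited from the plane. -/
abbrev UnitCircle : Type := Metric.sphere (0 : Plane) 1

/-- The arc length measure `σ` on the unit circle (total mass `2π`). -/
def arcMeasure : Measure UnitCircle := (volume : Measure Plane).toSphere

/-- The norm `‖h‖_Lip = sup |h(ω)| + sup_{ω ≠ ω'} |h(ω) - h(ω')| / |ω - ω'|`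
of a Lipschitz function on the unit circle. -/
def lipNorm (h : UnitCircle → ℂ) : ℝ :=
  (⨆ ω : UnitCircle, ‖h ω‖) +
    ⨆ p : {p : UnitCircle × UnitCircle // p.1 ≠ p.2},
      ‖h p.1.1 - h p.1.2‖ / dist p.1.1 p.1.2

/-- The complex Borel measure `hσ` on the plane, `(hσ)(E) = ∫_{𝕊¹ ∩ E} h dσ`. -/
def arcDensity (h : UnitCircle → ℂ) : ComplexMeasure Plane :=
  (arcMeasure.withDensityᵥ h).map (fun ω => (ω : Plane))

/-- The convolution of two complex Borel measures on the plane: the image of the product measure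
under addition. -/
def cconv (μ ν : ComplexMeasure Plane) : ComplexMeasure Plane :=
  (μ.prod ν (ContinuousLinearMap.mul ℝ ℂ)).map (fun p : Plane × Plane => p.1 + p.2)

/-- The four-fold convolution `h₁σ ∗ h₂σ ∗ h₃σ ∗ h₄σ`. -/
def fourConv (h : Fin 4 → UnitCircle → ℂ) : ComplexMeasure Plane :=
  cconv (cconv (cconv (arcDensity (h 0)) (arcDensity (h 1))) (arcDensity (h 2)))
    (arcDensity (h 3))

instance : IsFiniteMeasure arcMeasure := by
  unfold arcMeasure; infer_instance

theorem integrable_of_lipschitz {h : UnitCircle → ℂ} {K : NNReal} (hh : LipschitzWith K h) :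
    Integrable h arcMeasure :=
  hh.continuous.integrable_of_hasCompactSupport (HasCompactSupport.of_compactSpace h)

theorem arcDensity_apply {h : UnitCircle → ℂ} (hh : Integrable h arcMeasure) {E : Set Plane}
    (hE : MeasurableSet E) :
    arcDensity h E = ∫ ω in {ω : UnitCircle | (ω : Plane) ∈ E}, h ω ∂arcMeasure := by
  rw [arcDensity, VectorMeasure.map_apply _ measurable_subtype_coe hE,
    withDensityᵥ_apply hh (measurable_subtype_coe hE)]
  rfl

/-- Images of measures with integrable densities convolve as expected; in particular the product
measure in the definition of the convolution exists for them. -/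
theorem cconv_map {X Y : Type*} [MeasurableSpace X] [MeasurableSpace Y] {ρ : Measure X}
    {κ : Measure Y} [SFinite ρ] [SFinite κ] {f : X → ℂ} {g : Y → ℂ} (hf : Integrable f ρ)
    (hg : Integrable g κ) {φ : X → Plane} {ψ : Y → Plane} (hφ : Measurable φ)
    (hψ : Measurable ψ) :
    cconv ((ρ.withDensityᵥ f).map φ) ((κ.withDensityᵥ g).map ψ) =
      ((ρ.prod κ).withDensityᵥ (fun p => f p.1 * g p.2)).map (fun p => φ p.1 + ψ p.2) := by
  have hm : Measurable (fun p : X × Y => (φ p.1, ψ p.2)) := by fun_prop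
  have key : ((ρ.withDensityᵥ f).map φ).prod ((κ.withDensityᵥ g).map ψ)
      (ContinuousLinearMap.mul ℝ ℂ) =
      ((ρ.prod κ).withDensityᵥ (fun p => f p.1 * g p.2)).map (fun p => (φ p.1, ψ p.2)) := by
    apply VectorMeasure.prod_eq_of_forall_apply_prod
    intro s t hs ht
    have hpre : (fun p : X × Y => (φ p.1, ψ p.2)) ⁻¹' (s ×ˢ t) = (φ ⁻¹' s) ×ˢ (ψ ⁻¹' t) := rfl
    rw [VectorMeasure.map_apply _ hm (hs.prod ht), VectorMeasure.map_apply _ hφ hs,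
      VectorMeasure.map_apply _ hψ ht, withDensityᵥ_apply hf (hφ hs),
      withDensityᵥ_apply hg (hψ ht), withDensityᵥ_apply (hf.mul_prod hg) (hm (hs.prod ht)), hpre,
      setIntegral_prod_mul]
    rfl
  ext E hE
  have ha : Measurable (fun p : Plane × Plane => p.1 + p.2) := by fun_prop
  have hb : Measurable (fun p : X × Y => φ p.1 + ψ p.2) := by fun_prop
  rw [cconv, key, VectorMeasure.map_apply _ ha hE, VectorMeasure.map_apply _ hm (ha hE),
    VectorMeasure.map_apply _ hb hE]
  rfl

/-- The four-fold convolution is the image of `h₁ ⊗ h₂ ⊗ h₃ ⊗ h₄` under the sum map. -/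
theorem fourConv_eq {h : Fin 4 → UnitCircle → ℂ} (hh : ∀ j, Integrable (h j) arcMeasure) :
    fourConv h = ((((arcMeasure.prod arcMeasure).prod arcMeasure).prod arcMeasure).withDensityᵥ
      (fun p => h 0 p.1.1.1 * h 1 p.1.1.2 * h 2 p.1.2 * h 3 p.2)).map
      (fun p => (p.1.1.1 : Plane) + p.1.1.2 + p.1.2 + p.2) := by
  unfold fourConv arcDensity
  have m0 : Measurable (fun ω : UnitCircle => (ω : Plane)) := measurable_subtype_coe
  rw [cconv_map (hh 0) (hh 1) m0 m0,
    cconv_map ((hh 0).mul_prod (hh 1)) (hh 2) (by fun_prop) m0,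
    cconv_map (((hh 0).mul_prod (hh 1)).mul_prod (hh 2)) (hh 3) (by fun_prop) m0]

end

section

open scoped ENNReal Real Pointwise

/-! Identify the plane with `ℂ` and convolve in pairs. A point `z` with `0 < |z| < 2` is a sum of
two points of the circle in exactly one unordered way, so the convolution of two of the measures has
a density `F` (`pairDensity`): `2 / D(z)`, where `D(z) = |z| √(4 - |z|²)`, times the symmetrised
product of the two functions at these two points (`circleMeasure_prod_circleMeasure`). The four-fold
density is the convolution of two such `F` (`fourConv_eq_withDensity`).

`F` is not continuous, but away from the zeros of `D` the two points depend on `z` with modulus `√|z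
- z'| / D(z)`. Interpolating this with the trivial bound shows that `|F(z) - F(z')|` is at most a
constant times `|z - z'|^τ (D(z)^(-1-2τ) + D(z')^(-1-2τ))` (`norm_pairDensity_sub_le`). Hence both
the size and the increments of the four-fold density `G` are controlled by the convolution of
`D^(-1-2τ)` with itself.

That convolution is at most a constant times `|x|^(-5τ)` (`exists_lintegral_convWeight_mul_le`).
Trouble arises only as `x → 0`, when the two point singularities merge and the two boundary circles
become tangent to all orders. Where two singular factors meet, part of the exponent of the larger
factor is traded for a power of `|x|` (`inv_rpow_mul_inv_rpow_le`), leaving integrable exponents.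

So `G` is `τ`-Hölder with a loss of `|x|^(-5τ)`, and it vanishes for `|x| ≥ 4`. The factor `|x|^γ`
absorbs the loss as soon as `6τ ≤ γ` (`norm_rpow_mul_sub_le`). -/

/-! ### Power singularities on the line and on chords of a disc -/

/-- The larger of `u`, `v` is at least `d / 2`. Spend `κ` of its exponent on `d / 2` and replace it
by the smaller one in the rest. With `κ = 0` this merely merges two singularities; with `κ > 0` it
lowers the total exponent at the cost of a power of the separation. -/
theorem inv_rpow_mul_inv_rpow_le {u v d : ℝ≥0∞} (hu : u ≠ ⊤) (hv : v ≠ ⊤) (hd : d ≤ u + v)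
    {α β κ : ℝ} (hκ : 0 ≤ κ) (hα : κ ≤ α) (hβ : κ ≤ β) :
    (u ^ α)⁻¹ * (v ^ β)⁻¹ ≤
      ((d / 2) ^ κ)⁻¹ * ((u ^ (α + β - κ))⁻¹ + (v ^ (α + β - κ))⁻¹) := by
  have key : ∀ {u v : ℝ≥0∞} {α β : ℝ}, u ≠ ⊤ → v ≠ ⊤ → d ≤ u + v → κ ≤ α → κ ≤ β → u ≤ v →
      (u ^ α)⁻¹ * (v ^ β)⁻¹ ≤ ((d / 2) ^ κ)⁻¹ * (u ^ (α + β - κ))⁻¹ := by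
    intro u v α β hu hv hd hα hβ huv
    have hdv : d / 2 ≤ v := by
      refine ENNReal.div_le_of_le_mul (hd.trans ?_)
      rw [mul_two]; gcongr
    have hd2 : d / 2 ≠ ⊤ := ne_top_of_le_ne_top hv hdv
    have f1 : u ^ α ≠ ⊤ := ENNReal.rpow_ne_top_of_nonneg (by linarith) hu
    have f2 : v ^ β ≠ ⊤ := ENNReal.rpow_ne_top_of_nonneg (by linarith) hv
    have f3 : (d / 2) ^ κ ≠ ⊤ := ENNReal.rpow_ne_top_of_nonneg hκ hd2
    have f4 : u ^ (α + β - κ) ≠ ⊤ := ENNReal.rpow_ne_top_of_nonneg (by linarith) hu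
    rw [← ENNReal.mul_inv (Or.inr f2) (Or.inl f1), ← ENNReal.mul_inv (Or.inr f4) (Or.inl f3)]
    refine ENNReal.inv_le_inv.2 ?_
    calc (d / 2) ^ κ * u ^ (α + β - κ) = (d / 2) ^ κ * (u ^ α * u ^ (β - κ)) := by
          rw [← ENNReal.rpow_add_of_nonneg _ _ (by linarith) (by linarith)]; ring_nf
      _ ≤ v ^ κ * (u ^ α * v ^ (β - κ)) := by gcongr
      _ = u ^ α * (v ^ κ * v ^ (β - κ)) := by ring
      _ = u ^ α * v ^ β := by
          rw [← ENNReal.rpow_add_of_nonneg _ _ hκ (by linarith)]; ring_nf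
  rcases le_total u v with h | h
  · refine (key hu hv hd hα hβ h).trans ?_
    gcongr; exact le_self_add
  · rw [mul_comm ((u ^ α)⁻¹), add_comm α β]
    refine (key hv hu (by rwa [add_comm]) hβ hα h).trans ?_
    gcongr; exact le_add_self

theorem inv_rpow_mul_inv_rpow_le_add {u v : ℝ≥0∞} (hu : u ≠ ⊤) (hv : v ≠ ⊤)
    {α β : ℝ} (hα : 0 ≤ α) (hβ : 0 ≤ β) :
    (u ^ α)⁻¹ * (v ^ β)⁻¹ ≤ (u ^ (α + β))⁻¹ + (v ^ (α + β))⁻¹ := by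
  simpa using inv_rpow_mul_inv_rpow_le hu hv (zero_le (a := u + v)) le_rfl hα hβ

theorem measurable_inv_enorm_rpow (a α : ℝ) :
    Measurable fun w : ℝ => (‖w - a‖ₑ ^ α)⁻¹ := by fun_prop

theorem exists_setLIntegral_inv_rpow_le {α : ℝ} (h0 : 0 ≤ α) (h1 : α < 1) :
    ∃ C : ℝ≥0∞, C ≠ ⊤ ∧ ∀ a : ℝ, ∫⁻ w in Set.Icc (-2) 2, (‖w - a‖ₑ ^ α)⁻¹ ≤ C := by
  have hfin : ∫⁻ t in Metric.ball (0 : ℝ) 1, (‖t‖ₑ ^ α)⁻¹ ≠ ⊤ := by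
    have hi : IntegrableOn (fun t : ℝ => ‖t‖ ^ (-α)) (Metric.ball 0 1) := by
      refine integrableOn_ball_of_norm_le_rpow (C := 1) (α := α) (by simp) (by simpa using h1)
        ?_ (Measurable.aestronglyMeasurable (measurable_norm.pow_const _))
      refine Filter.Eventually.of_forall fun x => ?_
      rw [one_mul, Real.norm_of_nonneg (by positivity)]
    refine (lt_of_le_of_lt (lintegral_mono_ae ?_) hi.2).ne
    refine ae_restrict_of_ae ?_
    filter_upwards [compl_mem_ae_iff.2 (measure_singleton (0 : ℝ))] with t ht
    have ht' : 0 < ‖t‖ := norm_pos_iff.2 ht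
    rw [Real.enorm_of_nonneg (by positivity : (0 : ℝ) ≤ ‖t‖ ^ (-α)), ← ENNReal.ofReal_rpow_of_pos ht',
      ENNReal.rpow_neg, ofReal_norm]
  -- Outside the unit ball about `a` the integrand is at most `1`, and `4` is the length of the
  -- interval; inside, translation invariance makes the bound independent of `a`.
  refine ⟨(∫⁻ t in Metric.ball (0 : ℝ) 1, (‖t‖ₑ ^ α)⁻¹) + 4, by simp [hfin], fun a => ?_⟩
  have hpt : ∀ t : ℝ, (‖t‖ₑ ^ α)⁻¹ ≤
      (Metric.ball (0 : ℝ) 1).indicator (fun t => (‖t‖ₑ ^ α)⁻¹) t + 1 := by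
    intro t
    by_cases ht : t ∈ Metric.ball (0 : ℝ) 1
    · rw [Set.indicator_of_mem ht]; exact le_self_add
    · rw [Set.indicator_of_notMem ht, zero_add, ENNReal.inv_le_one]
      rw [← ENNReal.one_rpow α]
      refine ENNReal.rpow_le_rpow ?_ h0
      simp only [Metric.mem_ball, dist_zero_right, not_lt] at ht
      rwa [← ofReal_norm, ENNReal.one_le_ofReal]
  have hm : Measurable ((Metric.ball (0 : ℝ) 1).indicator fun t : ℝ => (‖t‖ₑ ^ α)⁻¹) :=
    Measurable.indicator (by fun_prop) measurableSet_ball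
  calc ∫⁻ w in Set.Icc (-2) 2, (‖w - a‖ₑ ^ α)⁻¹
      ≤ ∫⁻ w in Set.Icc (-2) 2,
        ((Metric.ball (0 : ℝ) 1).indicator (fun t => (‖t‖ₑ ^ α)⁻¹) (w - a) + 1) :=
        lintegral_mono fun w => hpt _
    _ = (∫⁻ w in Set.Icc (-2) 2,
        (Metric.ball (0 : ℝ) 1).indicator (fun t => (‖t‖ₑ ^ α)⁻¹) (w - a)) + 4 := by
        rw [lintegral_add_right _ measurable_const]
        congr 1
        rw [lintegral_const, Measure.restrict_apply_univ, Real.volume_Icc]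
        norm_num
    _ ≤ (∫⁻ w, (Metric.ball (0 : ℝ) 1).indicator (fun t => (‖t‖ₑ ^ α)⁻¹) (w - a)) + 4 := by
        gcongr; exact Measure.restrict_le_self
    _ = _ := by
        rw [lintegral_sub_right_eq_self (fun w =>
          (Metric.ball (0 : ℝ) 1).indicator (fun t => (‖t‖ₑ ^ α)⁻¹) w) a,
          lintegral_indicator measurableSet_ball]

/-- The shape of the one-dimensional singular integrals that occur on a chord of a disc. -/
theorem inv_rpow_sq_sub_sq_mul_le {c q : ℝ} (hc : 0 < c) (hq : q ^ 2 < c ^ 2) {β h κ : ℝ}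
    (hβ : 0 ≤ β) (hκ : 0 ≤ κ) (hh : κ ≤ h) :
    (‖q‖ₑ ^ β)⁻¹ * (ENNReal.ofReal (c ^ 2 - q ^ 2) ^ h)⁻¹ ≤
      (ENNReal.ofReal c ^ κ)⁻¹ * (2 * (‖q‖ₑ ^ (2 * h - κ + β))⁻¹ +
        ((‖q - c‖ₑ ^ (2 * h - κ + β))⁻¹ + (‖q - (-c)‖ₑ ^ (2 * h - κ + β))⁻¹)) := by
  have hlt := abs_lt_of_sq_lt_sq hq hc.le
  have hlt' := abs_lt.1 hlt
  have e : ENNReal.ofReal (c ^ 2 - q ^ 2) = ‖q - c‖ₑ * ‖q - (-c)‖ₑ := by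
    rw [← enorm_mul, ← ofReal_norm, Real.norm_eq_abs, abs_of_nonpos (by nlinarith)]
    congr 1; ring
  -- The endpoints `c` and `-c` of the chord are `2c` apart, so the separation lemma yields the
  -- factor `c^(-κ)`.
  have hP := inv_rpow_mul_inv_rpow_le (u := ‖q - c‖ₑ) (v := ‖q - (-c)‖ₑ)
    (d := ENNReal.ofReal (2 * c)) enorm_ne_top enorm_ne_top (by
      rw [← ofReal_norm, ← ofReal_norm, ← ENNReal.ofReal_add (norm_nonneg _) (norm_nonneg _)]
      apply ENNReal.ofReal_le_ofReal
      rw [Real.norm_eq_abs, Real.norm_eq_abs]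
      have h1 := neg_abs_le (q - c)
      have h2 := le_abs_self (q - (-c))
      linarith) hκ hh hh
  have e2 : ENNReal.ofReal (2 * c) / 2 = ENNReal.ofReal c := by
    rw [ENNReal.ofReal_mul (by norm_num), ENNReal.ofReal_ofNat, mul_comm,
      ENNReal.mul_div_cancel_right (by norm_num) (by norm_num)]
  rw [e2] at hP
  have hQ : ∀ t : ℝ, (‖q‖ₑ ^ β)⁻¹ * (‖t‖ₑ ^ (h + h - κ))⁻¹ ≤
      (‖q‖ₑ ^ (2 * h - κ + β))⁻¹ + (‖t‖ₑ ^ (2 * h - κ + β))⁻¹ := by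
    intro t
    refine (inv_rpow_mul_inv_rpow_le_add enorm_ne_top enorm_ne_top hβ (by linarith)).trans ?_
    rw [show β + (h + h - κ) = 2 * h - κ + β by ring]
  have ht : ∀ {x : ℝ≥0∞}, x ≠ ⊤ → x ^ h ≠ ⊤ := fun hx =>
    ENNReal.rpow_ne_top_of_nonneg (by linarith) hx
  rw [e, ENNReal.mul_rpow_of_nonneg _ _ (by linarith),
    ENNReal.mul_inv (Or.inr (ht enorm_ne_top)) (Or.inl (ht enorm_ne_top))]
  calc _ ≤ (‖q‖ₑ ^ β)⁻¹ * ((ENNReal.ofReal c ^ κ)⁻¹ *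
        ((‖q - c‖ₑ ^ (h + h - κ))⁻¹ + (‖q - (-c)‖ₑ ^ (h + h - κ))⁻¹)) := by gcongr
    _ = (ENNReal.ofReal c ^ κ)⁻¹ * ((‖q‖ₑ ^ β)⁻¹ * (‖q - c‖ₑ ^ (h + h - κ))⁻¹ +
        (‖q‖ₑ ^ β)⁻¹ * (‖q - (-c)‖ₑ ^ (h + h - κ))⁻¹) := by ring
    _ ≤ (ENNReal.ofReal c ^ κ)⁻¹ *
        (((‖q‖ₑ ^ (2 * h - κ + β))⁻¹ + (‖q - c‖ₑ ^ (2 * h - κ + β))⁻¹) +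
        ((‖q‖ₑ ^ (2 * h - κ + β))⁻¹ + (‖q - (-c)‖ₑ ^ (2 * h - κ + β))⁻¹)) := by
        gcongr <;> exact hQ _
    _ = _ := by ring

/-- The reciprocal of the `h`-th power of `4 - p² - q²` on the disc of radius `2`. -/
noncomputable def discWeight (h p q : ℝ) : ℝ≥0∞ :=
  if p ^ 2 + q ^ 2 < 4 then (ENNReal.ofReal (4 - p ^ 2 - q ^ 2) ^ h)⁻¹ else 0

theorem measurable_discWeight (h : ℝ) : Measurable fun y : ℝ × ℝ => discWeight h y.1 y.2 := by
  unfold discWeight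
  refine Measurable.ite (measurableSet_lt (by fun_prop) (by fun_prop)) ?_ measurable_const
  fun_prop

/-- Integrate over vertical chords. With `c` the half-length of the chord at `p`, the `q`-integral
costs `c^(-κ)` and converges if `2h - κ + β < 1`. Since `c² = |p - (m + 2)| |p - (m - 2)|`, this
cost is a singularity of order `κ / 2` at each end of the diameter, which combines with `|p -
a|^(-α)` and converges if `κ / 2 + α < 1`. Thus `κ` distributes the boundary singularity between the
two variables. Uniformity in `a` and `m` is essential, as both will vary with `|x|`. -/
theorem exists_setLIntegral_discWeight_le {α β h κ : ℝ} (hα : 0 ≤ α) (hβ : 0 ≤ β) (hκ : 0 ≤ κ)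
    (hh : κ ≤ h) (h1 : 2 * h - κ + β < 1) (h2 : κ / 2 + α < 1) :
    ∃ C : ℝ≥0∞, C ≠ ⊤ ∧ ∀ a m : ℝ, ∫⁻ p in Set.Icc (-2) 2, ∫⁻ q in Set.Icc (-2) 2,
      (‖p - a‖ₑ ^ α)⁻¹ * ((‖q‖ₑ ^ β)⁻¹ * discWeight h (p - m) q) ≤ C := by
  obtain ⟨C₁, hC₁, H₁⟩ := exists_setLIntegral_inv_rpow_le (α := 2 * h - κ + β) (by linarith) h1
  obtain ⟨C₂, hC₂, H₂⟩ := exists_setLIntegral_inv_rpow_le (α := κ / 2 + α) (by linarith) h2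
  refine ⟨4 * C₂ * (4 * C₁), by finiteness, fun a m => ?_⟩
  have inner : ∀ p : ℝ, ∫⁻ q in Set.Icc (-2) 2,
      (‖p - a‖ₑ ^ α)⁻¹ * ((‖q‖ₑ ^ β)⁻¹ * discWeight h (p - m) q) ≤
      ((‖p - a‖ₑ ^ (κ / 2 + α))⁻¹ + (‖p - (m + 2)‖ₑ ^ (κ / 2 + α))⁻¹ +
        ((‖p - a‖ₑ ^ (κ / 2 + α))⁻¹ + (‖p - (m - 2)‖ₑ ^ (κ / 2 + α))⁻¹)) * (4 * C₁) := by
    intro p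
    rw [lintegral_const_mul _ (by
      refine Measurable.mul (by fun_prop) ?_
      exact (measurable_discWeight h).comp (measurable_const.prodMk measurable_id))]
    by_cases hp : (p - m) ^ 2 < 4
    · set c := Real.sqrt (4 - (p - m) ^ 2) with hc_def
      have hc : 0 < c := Real.sqrt_pos.2 (by linarith)
      have hc2 : c ^ 2 = 4 - (p - m) ^ 2 := Real.sq_sqrt (by linarith)
      have hq := fun a => measurable_inv_enorm_rpow a (2 * h - κ + β)
      have hI : ∫⁻ q in Set.Icc (-2) 2, (‖q‖ₑ ^ β)⁻¹ * discWeight h (p - m) q ≤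
          (ENNReal.ofReal c ^ κ)⁻¹ * (4 * C₁) := by
        calc _ ≤ ∫⁻ q in Set.Icc (-2) 2, (ENNReal.ofReal c ^ κ)⁻¹ *
            (2 * (‖q - 0‖ₑ ^ (2 * h - κ + β))⁻¹ + ((‖q - c‖ₑ ^ (2 * h - κ + β))⁻¹ +
              (‖q - (-c)‖ₑ ^ (2 * h - κ + β))⁻¹)) := by
              refine lintegral_mono fun q => ?_
              by_cases hq : (p - m) ^ 2 + q ^ 2 < 4
              · rw [discWeight, if_pos hq, ← hc2, sub_zero]
                exact inv_rpow_sq_sub_sq_mul_le hc (by linarith) hβ hκ hh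
              · simp [discWeight, if_neg hq]
          _ ≤ _ := by
              rw [lintegral_const_mul _ (by fun_prop), lintegral_add_left (by fun_prop),
                lintegral_const_mul _ (hq _), lintegral_add_left (hq _)]
              gcongr
              calc _ ≤ 2 * C₁ + (C₁ + C₁) := by gcongr <;> exact H₁ _
                _ = 4 * C₁ := by ring
      have hcp : (ENNReal.ofReal c ^ κ)⁻¹ ≤
          (‖p - (m + 2)‖ₑ ^ (κ / 2))⁻¹ + (‖p - (m - 2)‖ₑ ^ (κ / 2))⁻¹ := by
        have e : ENNReal.ofReal c ^ κ =
            ‖p - (m + 2)‖ₑ ^ (κ / 2) * ‖p - (m - 2)‖ₑ ^ (κ / 2) := by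
          rw [← ENNReal.mul_rpow_of_nonneg _ _ (by linarith), ← enorm_mul,
            show (p - (m + 2)) * (p - (m - 2)) = -(c ^ 2) by rw [hc2]; ring, enorm_neg,
            Real.enorm_of_nonneg (by positivity), ENNReal.ofReal_pow hc.le,
            ← ENNReal.rpow_natCast, ← ENNReal.rpow_mul]
          congr 1; push_cast; ring
        have ht : ∀ {x : ℝ≥0∞}, x ≠ ⊤ → x ^ (κ / 2) ≠ ⊤ := fun hx =>
          ENNReal.rpow_ne_top_of_nonneg (by linarith) hx
        rw [e, ENNReal.mul_inv (Or.inr (ht enorm_ne_top)) (Or.inl (ht enorm_ne_top))]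
        refine (inv_rpow_mul_inv_rpow_le (d := ENNReal.ofReal 4) enorm_ne_top enorm_ne_top ?_
          (by linarith) le_rfl le_rfl).trans ?_
        · rw [← ofReal_norm, ← ofReal_norm,
            ← ENNReal.ofReal_add (norm_nonneg _) (norm_nonneg _)]
          apply ENNReal.ofReal_le_ofReal
          rw [Real.norm_eq_abs, Real.norm_eq_abs]
          have h1 := neg_abs_le (p - (m + 2))
          have h2 := le_abs_self (p - (m - 2))
          linarith
        · rw [show κ / 2 + κ / 2 - κ / 2 = κ / 2 by ring]
          refine mul_le_of_le_one_left' ?_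
          rw [ENNReal.inv_le_one]
          refine (ENNReal.one_rpow (κ / 2)).symm.le.trans
            (ENNReal.rpow_le_rpow ?_ (by linarith))
          rw [← ENNReal.ofReal_ofNat 2, ← ENNReal.ofReal_div_of_pos (by norm_num),
            ENNReal.one_le_ofReal]
          norm_num
      have hQ : ∀ t : ℝ, (‖p - a‖ₑ ^ α)⁻¹ * (‖t‖ₑ ^ (κ / 2))⁻¹ ≤
          (‖p - a‖ₑ ^ (κ / 2 + α))⁻¹ + (‖t‖ₑ ^ (κ / 2 + α))⁻¹ := by
        intro t
        rw [add_comm (κ / 2) α]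
        exact inv_rpow_mul_inv_rpow_le_add enorm_ne_top enorm_ne_top hα (by linarith)
      calc _ ≤ (‖p - a‖ₑ ^ α)⁻¹ * (((‖p - (m + 2)‖ₑ ^ (κ / 2))⁻¹ +
            (‖p - (m - 2)‖ₑ ^ (κ / 2))⁻¹) * (4 * C₁)) := by
            gcongr; exact hI.trans (by gcongr)
        _ = ((‖p - a‖ₑ ^ α)⁻¹ * (‖p - (m + 2)‖ₑ ^ (κ / 2))⁻¹ +
            (‖p - a‖ₑ ^ α)⁻¹ * (‖p - (m - 2)‖ₑ ^ (κ / 2))⁻¹) * (4 * C₁) := by ring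
        _ ≤ _ := by gcongr <;> exact hQ _
    · have hz : ∀ q, discWeight h (p - m) q = 0 := fun q =>
        if_neg (by nlinarith [sq_nonneg q])
      simp [hz]
  calc _ ≤ ∫⁻ p in Set.Icc (-2) 2,
      ((‖p - a‖ₑ ^ (κ / 2 + α))⁻¹ + (‖p - (m + 2)‖ₑ ^ (κ / 2 + α))⁻¹ +
        ((‖p - a‖ₑ ^ (κ / 2 + α))⁻¹ + (‖p - (m - 2)‖ₑ ^ (κ / 2 + α))⁻¹)) * (4 * C₁) :=
        lintegral_mono fun p => inner p
    _ ≤ _ := by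
      have hm := fun a => measurable_inv_enorm_rpow a (κ / 2 + α)
      rw [lintegral_mul_const _ (by fun_prop)]
      gcongr
      rw [lintegral_add_left (by fun_prop), lintegral_add_left (hm _),
        lintegral_add_left (hm _)]
      calc _ ≤ C₂ + C₂ + (C₂ + C₂) := by gcongr <;> exact H₂ _
        _ = 4 * C₂ := by ring

/-! ### The convolution of the singular weight with itself -/

/-- The `s`-th power of the reciprocal of `‖z‖ √(4 - ‖z‖²)` on the disc of radius `2`, which
dominates the singularities of a two-fold convolution of arc measures. -/
noncomputable def convWeight (s : ℝ) (z : ℂ) : ℝ≥0∞ :=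
  if ‖z‖ < 2 then (‖z‖ₑ ^ s)⁻¹ * (ENNReal.ofReal (4 - ‖z‖ ^ 2) ^ (s / 2))⁻¹ else 0

theorem measurable_convWeight (s : ℝ) : Measurable (convWeight s) := by
  unfold convWeight
  refine Measurable.ite (measurableSet_lt (by fun_prop) (by fun_prop)) ?_ measurable_const
  fun_prop

theorem norm_lt_two_iff (z : ℂ) : z.re ^ 2 + z.im ^ 2 < 4 ↔ ‖z‖ < 2 := by
  rw [← sq_lt_sq₀ (norm_nonneg z) (by norm_num), Complex.sq_norm, Complex.normSq_apply]
  constructor <;> intro h <;> linarith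

theorem discWeight_zero (z : ℂ) : discWeight 0 z.re z.im = if ‖z‖ < 2 then 1 else 0 := by
  simp [discWeight, norm_lt_two_iff]

/-- The singularities at the centre and on the boundary circle do not meet: for `‖z‖ ≤ 1` the
boundary factor is at most `1`, and for `‖z‖ ≥ 1` the central one is. `discWeight 0` serves as the
indicator of the disc. -/
theorem convWeight_le {s : ℝ} (hs : 0 ≤ s) (z : ℂ) :
    convWeight s z ≤
      (‖z‖ₑ ^ s)⁻¹ * discWeight 0 z.re z.im + discWeight (s / 2) z.re z.im := by
  by_cases hz : ‖z‖ < 2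
  swap
  · simp [convWeight, hz]
  rw [discWeight_zero, convWeight, discWeight, if_pos hz, if_pos hz,
    if_pos ((norm_lt_two_iff z).2 hz), mul_one]
  have e : 4 - z.re ^ 2 - z.im ^ 2 = 4 - ‖z‖ ^ 2 := by
    rw [Complex.sq_norm, Complex.normSq_apply]; ring
  rw [e]
  have one_le : ∀ {x : ℝ≥0∞} {a : ℝ}, 1 ≤ x → 0 ≤ a → (x ^ a)⁻¹ ≤ 1 := by
    intro x a hx ha
    rw [ENNReal.inv_le_one]
    exact (ENNReal.one_rpow a).symm.le.trans (ENNReal.rpow_le_rpow hx ha)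
  rcases le_total ‖z‖ 1 with h1 | h1
  · refine le_add_right (mul_le_of_le_one_right' (one_le ?_ (by linarith)))
    rw [ENNReal.one_le_ofReal]; nlinarith [norm_nonneg z]
  · refine le_add_left (mul_le_of_le_one_left' (one_le ?_ hs))
    rwa [← ofReal_norm, ENNReal.one_le_ofReal]

theorem inv_enorm_rpow_add_le (z : ℂ) {a b : ℝ} (ha : 0 ≤ a) (hb : 0 ≤ b) :
    (‖z‖ₑ ^ (a + b))⁻¹ ≤ (‖z.re‖ₑ ^ a)⁻¹ * (‖z.im‖ₑ ^ b)⁻¹ := by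
  have h1 : ‖z.re‖ₑ ≤ ‖z‖ₑ := by
    rw [← ofReal_norm, ← ofReal_norm]; exact ENNReal.ofReal_le_ofReal (Complex.abs_re_le_norm z)
  have h2 : ‖z.im‖ₑ ≤ ‖z‖ₑ := by
    rw [← ofReal_norm, ← ofReal_norm]; exact ENNReal.ofReal_le_ofReal (Complex.abs_im_le_norm z)
  rw [← ENNReal.mul_inv (Or.inr (ENNReal.rpow_ne_top_of_nonneg hb enorm_ne_top))
    (Or.inl (ENNReal.rpow_ne_top_of_nonneg ha enorm_ne_top)), ENNReal.inv_le_inv,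
    ENNReal.rpow_add_of_nonneg _ _ ha hb]
  gcongr

theorem inv_rpow_le_four_mul_inv_rpow {r : ℝ≥0∞} (hr : r ≤ 4) {a b : ℝ} (ha : 0 ≤ a)
    (hab : a ≤ b) (hb : b ≤ 1) : (r ^ a)⁻¹ ≤ 4 * (r ^ b)⁻¹ := by
  have hrt : r ≠ ⊤ := ne_top_of_le_ne_top (by norm_num) hr
  have h1 : r ^ b ≤ r ^ a * 4 := by
    rw [show b = a + (b - a) by ring, ENNReal.rpow_add_of_nonneg _ _ ha (by linarith)]
    gcongr
    calc r ^ (b - a) ≤ 4 ^ (b - a) := ENNReal.rpow_le_rpow hr (by linarith)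
      _ ≤ 4 ^ (1 : ℝ) := ENNReal.rpow_le_rpow_of_exponent_le (by norm_num) (by linarith)
      _ = 4 := by simp
  have h2 : (r ^ a * 4)⁻¹ ≤ (r ^ b)⁻¹ := ENNReal.inv_le_inv.2 h1
  rw [ENNReal.mul_inv (Or.inr (by norm_num)) (Or.inr (by norm_num))] at h2
  calc (r ^ a)⁻¹ = 4 * ((r ^ a)⁻¹ * 4⁻¹) := by
        rw [mul_comm, mul_assoc, ENNReal.inv_mul_cancel (by norm_num) (by norm_num), mul_one]
    _ ≤ _ := by gcongr

theorem discWeight_neg (h p q : ℝ) : discWeight h (-p) (-q) = discWeight h p q := by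
  simp [discWeight]

/-- The defining functions of the two discs differ by `2 R (p - R / 2)` in absolute value, so on the
common part their sum is at least `2 R |p - R / 2|`. The separation lemma with `κ = 4τ` then
replaces the product of the weights by their sum, away from the radical axis `p = R / 2`. -/
theorem discWeight_mul_discWeight_le {τ R p q : ℝ} (hτ : 0 ≤ τ) (hτ' : 4 * τ ≤ 1 / 2)
    (hR : 0 < R) :
    discWeight (1 / 2 + τ) p q * discWeight (1 / 2 + τ) (p - R) q ≤
      (ENNReal.ofReal R ^ (4 * τ))⁻¹ * ((‖p - R / 2‖ₑ ^ (4 * τ))⁻¹ *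
        (discWeight (1 - 2 * τ) p q + discWeight (1 - 2 * τ) (p - R) q)) := by
  by_cases h1 : p ^ 2 + q ^ 2 < 4
  swap
  · simp [discWeight, h1]
  by_cases h2 : (p - R) ^ 2 + q ^ 2 < 4
  swap
  · simp [discWeight, h2]
  simp only [discWeight, if_pos h1, if_pos h2]
  have ht : ∀ {x : ℝ≥0∞}, x ≠ ⊤ → x ^ (4 * τ) ≠ ⊤ := fun hx =>
    ENNReal.rpow_ne_top_of_nonneg (by linarith) hx
  refine (inv_rpow_mul_inv_rpow_le (κ := 4 * τ) (d := ENNReal.ofReal (R * |p - R / 2|) * 2)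
    ENNReal.ofReal_ne_top ENNReal.ofReal_ne_top ?_ (by linarith) (by linarith)
      (by linarith)).trans_eq ?_
  · rw [← ENNReal.ofReal_add (by linarith) (by linarith), ← ENNReal.ofReal_ofNat 2,
      ← ENNReal.ofReal_mul (by positivity)]
    apply ENNReal.ofReal_le_ofReal
    rcases abs_cases (p - R / 2) with ⟨h, -⟩ | ⟨h, -⟩ <;> rw [h] <;> nlinarith
  · rw [ENNReal.mul_div_cancel_right (by norm_num) (by norm_num), ENNReal.ofReal_mul hR.le,
      ENNReal.mul_rpow_of_nonneg _ _ (by linarith), ← Real.norm_eq_abs, ofReal_norm,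
      ENNReal.mul_inv (Or.inr (ht enorm_ne_top)) (Or.inl (ht ENNReal.ofReal_ne_top)),
      show 1 / 2 + τ + (1 / 2 + τ) - 4 * τ = 1 - 2 * τ by ring, mul_assoc]

/-- A product of singular factors in the two coordinates and a weight on the disc of radius `2`
centred at `(m, 0)`. -/
noncomputable def singKernel (α β h a m : ℝ) (y : ℝ × ℝ) : ℝ≥0∞ :=
  (‖y.1 - a‖ₑ ^ α)⁻¹ * ((‖y.2‖ₑ ^ β)⁻¹ * discWeight h (y.1 - m) y.2)

theorem measurable_singKernel (α β h a m : ℝ) : Measurable (singKernel α β h a m) := by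
  refine Measurable.mul (by fun_prop) (Measurable.mul (by fun_prop) ?_)
  exact (measurable_discWeight h).comp (by fun_prop : Measurable fun y : ℝ × ℝ =>
    (y.1 - m, y.2))

/-- Expand centre plus boundary against centre plus boundary. Centre against centre: trade `5τ` for
a power of `R`, which leaves total exponent `2 - τ < 2`. Centre against boundary: split `1 + 2τ` as
`(1 - 6τ) + 8τ` over the coordinates, with no loss in `R`. Boundary against boundary: use the
radical axis, with loss `4τ`. As `R ≤ 4`, all losses are dominated by `8 R^(-5τ)`. -/
theorem convWeight_mul_convWeight_le {τ R : ℝ} (hτ : 0 < τ) (hτ' : τ ≤ 1 / 40) (hR : 0 < R)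
    (hR4 : R ≤ 4) (y : ℂ) :
    convWeight (1 + 2 * τ) y * convWeight (1 + 2 * τ) (R - y) ≤
      8 * (ENNReal.ofReal R ^ (5 * τ))⁻¹ *
        (singKernel (1 - τ / 2) (1 - τ / 2) 0 0 0 (y.re, y.im) +
          singKernel (1 - τ / 2) (1 - τ / 2) 0 R R (y.re, y.im) +
          singKernel (1 - 6 * τ) (8 * τ) (1 / 2 + τ) 0 R (y.re, y.im) +
          singKernel (1 - 6 * τ) (8 * τ) (1 / 2 + τ) R 0 (y.re, y.im) +
          singKernel (4 * τ) 0 (1 - 2 * τ) (R / 2) 0 (y.re, y.im) +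
          singKernel (4 * τ) 0 (1 - 2 * τ) (R / 2) R (y.re, y.im)) := by
  unfold singKernel
  set r := ENNReal.ofReal R with hr
  have hr4 : r ≤ 4 := by
    rw [hr, ← ENNReal.ofReal_ofNat 4]; exact ENNReal.ofReal_le_ofReal hR4
  have hw1 := convWeight_le (s := 1 + 2 * τ) (by linarith) y
  have hw2 := convWeight_le (s := 1 + 2 * τ) (by linarith) (R - y)
  have hs : (1 + 2 * τ) / 2 = 1 / 2 + τ := by ring
  have hre : ((R : ℂ) - y).re = -(y.re - R) := by simp
  have him : ((R : ℂ) - y).im = -y.im := by simp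
  simp only [hre, him, discWeight_neg, hs] at hw1 hw2
  have sing1 := inv_enorm_rpow_add_le y (a := 1 - 6 * τ) (b := 8 * τ) (by linarith) (by linarith)
  have sing2 := inv_enorm_rpow_add_le (R - y) (a := 1 - 6 * τ) (b := 8 * τ)
    (by linarith) (by linarith)
  have sing3 := inv_enorm_rpow_add_le y (a := 1 - τ / 2) (b := 1 - τ / 2)
    (by linarith) (by linarith)
  have sing4 := inv_enorm_rpow_add_le (R - y) (a := 1 - τ / 2) (b := 1 - τ / 2)
    (by linarith) (by linarith)
  rw [show 1 - 6 * τ + 8 * τ = 1 + 2 * τ by ring] at sing1 sing2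
  simp only [hre, him, enorm_neg] at sing2 sing4
  have hPP := inv_rpow_mul_inv_rpow_le (u := ‖y‖ₑ) (v := ‖(R : ℂ) - y‖ₑ) (d := r)
    (α := 1 + 2 * τ) (β := 1 + 2 * τ) (κ := 5 * τ) enorm_ne_top enorm_ne_top (by
      rw [hr, ← Real.enorm_of_nonneg hR.le]
      calc ‖R‖ₑ = ‖y + ((R : ℂ) - y)‖ₑ := by
            rw [add_sub_cancel, ← ofReal_norm, ← ofReal_norm, Complex.norm_real]
        _ ≤ _ := enorm_add_le _ _) (by linarith) (by linarith) (by linarith)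
  rw [show 1 + 2 * τ + (1 + 2 * τ) - 5 * τ = 1 - τ / 2 + (1 - τ / 2) by ring] at hPP
  have c1 : ((r / 2) ^ (5 * τ))⁻¹ ≤ 8 * (r ^ (5 * τ))⁻¹ := by
    have h1 : r ^ (5 * τ) ≤ (r / 2) ^ (5 * τ) * 8 := by
      calc r ^ (5 * τ) = (r / 2) ^ (5 * τ) * 2 ^ (5 * τ) := by
            rw [← ENNReal.mul_rpow_of_nonneg _ _ (by linarith),
              ENNReal.div_mul_cancel (by norm_num) (by norm_num)]
        _ ≤ (r / 2) ^ (5 * τ) * 2 ^ (1 : ℝ) := by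
            gcongr
            · norm_num
            · linarith
        _ ≤ _ := by rw [ENNReal.rpow_one]; gcongr; norm_num
    have h2 : ((r / 2) ^ (5 * τ) * 8)⁻¹ ≤ (r ^ (5 * τ))⁻¹ := ENNReal.inv_le_inv.2 h1
    rw [ENNReal.mul_inv (Or.inr (by norm_num)) (Or.inr (by norm_num))] at h2
    calc ((r / 2) ^ (5 * τ))⁻¹ = 8 * (((r / 2) ^ (5 * τ))⁻¹ * 8⁻¹) := by
          rw [mul_comm 8, mul_assoc, ENNReal.inv_mul_cancel (by norm_num) (by norm_num), mul_one]
      _ ≤ _ := by gcongr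
  have c2 : 1 ≤ 8 * (r ^ (5 * τ))⁻¹ := by
    have := inv_rpow_le_four_mul_inv_rpow hr4 le_rfl (b := 5 * τ) (by linarith) (by linarith)
    rw [ENNReal.rpow_zero, inv_one] at this
    refine this.trans ?_
    gcongr; norm_num
  have c3 : (r ^ (4 * τ))⁻¹ ≤ 8 * (r ^ (5 * τ))⁻¹ := by
    refine (inv_rpow_le_four_mul_inv_rpow hr4 (by linarith) (b := 5 * τ) (by linarith)
      (by linarith)).trans ?_
    gcongr; norm_num
  have d0 : ∀ p q, discWeight 0 p q ≤ 1 := by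
    intro p q; unfold discWeight; split_ifs <;> simp
  have T3 := discWeight_mul_discWeight_le (p := y.re) (q := y.im) hτ.le (by linarith) hR
  rw [← hr] at T3
  -- From here only `c1`, `c2` and `c3` matter: `c` dominates each of the three losses.
  generalize hc : 8 * (r ^ (5 * τ))⁻¹ = c at *
  simp only [sub_zero, ENNReal.rpow_zero, inv_one, one_mul]
  set X := ‖y‖ₑ
  set Y := ‖(R : ℂ) - y‖ₑ
  have T1 : (X ^ (1 + 2 * τ))⁻¹ * discWeight 0 y.re y.im *
      ((Y ^ (1 + 2 * τ))⁻¹ * discWeight 0 (y.re - R) y.im) ≤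
      c * ((‖y.re‖ₑ ^ (1 - τ / 2))⁻¹ * ((‖y.im‖ₑ ^ (1 - τ / 2))⁻¹ * discWeight 0 y.re y.im) +
        (‖y.re - R‖ₑ ^ (1 - τ / 2))⁻¹ * ((‖y.im‖ₑ ^ (1 - τ / 2))⁻¹ *
          discWeight 0 (y.re - R) y.im)) := by
    calc _ = (X ^ (1 + 2 * τ))⁻¹ * (Y ^ (1 + 2 * τ))⁻¹ *
          (discWeight 0 y.re y.im * discWeight 0 (y.re - R) y.im) := by ring
      _ ≤ c * ((‖y.re‖ₑ ^ (1 - τ / 2))⁻¹ * (‖y.im‖ₑ ^ (1 - τ / 2))⁻¹ +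
          (‖y.re - R‖ₑ ^ (1 - τ / 2))⁻¹ * (‖y.im‖ₑ ^ (1 - τ / 2))⁻¹) *
          (discWeight 0 y.re y.im * discWeight 0 (y.re - R) y.im) := by
          refine mul_le_mul' (hPP.trans ?_) le_rfl
          gcongr
      _ = c * ((‖y.re‖ₑ ^ (1 - τ / 2))⁻¹ * ((‖y.im‖ₑ ^ (1 - τ / 2))⁻¹ *
            (discWeight 0 y.re y.im * discWeight 0 (y.re - R) y.im)) +
          (‖y.re - R‖ₑ ^ (1 - τ / 2))⁻¹ * ((‖y.im‖ₑ ^ (1 - τ / 2))⁻¹ *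
            (discWeight 0 y.re y.im * discWeight 0 (y.re - R) y.im))) := by ring
      _ ≤ _ := by
          gcongr
          · exact mul_le_of_le_one_right' (d0 _ _)
          · exact mul_le_of_le_one_left' (d0 _ _)
  have T2 : (X ^ (1 + 2 * τ))⁻¹ * discWeight 0 y.re y.im *
      discWeight (1 / 2 + τ) (y.re - R) y.im ≤
      c * ((‖y.re‖ₑ ^ (1 - 6 * τ))⁻¹ * ((‖y.im‖ₑ ^ (8 * τ))⁻¹ *
            discWeight (1 / 2 + τ) (y.re - R) y.im)) := by
    calc _ ≤ (‖y.re‖ₑ ^ (1 - 6 * τ))⁻¹ * (‖y.im‖ₑ ^ (8 * τ))⁻¹ * 1 *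
          discWeight (1 / 2 + τ) (y.re - R) y.im := by gcongr; exact d0 _ _
      _ = 1 * ((‖y.re‖ₑ ^ (1 - 6 * τ))⁻¹ * ((‖y.im‖ₑ ^ (8 * τ))⁻¹ *
            discWeight (1 / 2 + τ) (y.re - R) y.im)) := by ring
      _ ≤ _ := by gcongr
  have T2' : discWeight (1 / 2 + τ) y.re y.im *
      ((Y ^ (1 + 2 * τ))⁻¹ * discWeight 0 (y.re - R) y.im) ≤
      c * ((‖y.re - R‖ₑ ^ (1 - 6 * τ))⁻¹ * ((‖y.im‖ₑ ^ (8 * τ))⁻¹ *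
            discWeight (1 / 2 + τ) y.re y.im)) := by
    calc _ ≤ discWeight (1 / 2 + τ) y.re y.im *
          ((‖y.re - R‖ₑ ^ (1 - 6 * τ))⁻¹ * (‖y.im‖ₑ ^ (8 * τ))⁻¹ * 1) := by
          gcongr; exact d0 _ _
      _ = 1 * ((‖y.re - R‖ₑ ^ (1 - 6 * τ))⁻¹ * ((‖y.im‖ₑ ^ (8 * τ))⁻¹ *
            discWeight (1 / 2 + τ) y.re y.im)) := by ring
      _ ≤ _ := by gcongr
  have T3' := T3.trans (mul_le_mul_left c3 _)
  refine (mul_le_mul' hw1 hw2).trans ?_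
  rw [add_mul, mul_add, mul_add]
  refine (add_le_add (add_le_add T1 T2) (add_le_add T2' T3')).trans_eq ?_
  ring

theorem convWeight_eq_zero {s : ℝ} {z : ℂ} (hz : 2 ≤ ‖z‖) : convWeight s z = 0 :=
  if_neg (not_lt.2 hz)

theorem convWeight_mul_of_norm_eq_one (s : ℝ) {u : ℂ} (hu : ‖u‖ = 1) (z : ℂ) :
    convWeight s (u * z) = convWeight s z := by
  have : ‖u * z‖ = ‖z‖ := by rw [norm_mul, hu, one_mul]
  simp only [convWeight, ← ofReal_norm, this]

theorem lintegral_mul_left_of_norm_eq_one (f : ℂ → ℝ≥0∞) {u : ℂ} (hu : ‖u‖ = 1) :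
    ∫⁻ z, f (u * z) = ∫⁻ z, f z := by
  have h := (rotation ⟨u, by simp [Submonoid.unitSphere, hu]⟩).measurePreserving
  exact h.lintegral_comp_emb
    (rotation ⟨u, by simp [Submonoid.unitSphere, hu]⟩).toHomeomorph.measurableEmbedding f

theorem lintegral_complex_eq (f : ℂ → ℝ≥0∞) (hf : Measurable f)
    (h0 : ∀ z : ℂ, 2 ≤ ‖z‖ → f z = 0) :
    ∫⁻ z, f z = ∫⁻ p in Set.Icc (-2 : ℝ) 2, ∫⁻ q in Set.Icc (-2 : ℝ) 2, f ⟨p, q⟩ := by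
  have hm : Measurable fun p : ℝ × ℝ => f ⟨p.1, p.2⟩ :=
    hf.comp Complex.measurableEquivRealProd.symm.measurable
  rw [← (Complex.volume_preserving_equiv_real_prod.symm).lintegral_comp_emb
    Complex.measurableEquivRealProd.symm.measurableEmbedding]
  have h1 : ∫⁻ p : ℝ × ℝ, f ⟨p.1, p.2⟩ =
      ∫⁻ p in Set.Icc (-2 : ℝ) 2 ×ˢ Set.Icc (-2 : ℝ) 2, f ⟨p.1, p.2⟩ := by
    symm
    rw [← lintegral_indicator (measurableSet_Icc.prod measurableSet_Icc)]
    refine lintegral_congr fun p => ?_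
    by_cases hp : p ∈ Set.Icc (-2 : ℝ) 2 ×ˢ Set.Icc (-2 : ℝ) 2
    · rw [Set.indicator_of_mem hp]
    · rw [Set.indicator_of_notMem hp, h0]
      by_contra! hlt
      exact hp ⟨abs_le.1 ((Complex.abs_re_le_norm ⟨p.1, p.2⟩).trans hlt.le),
        abs_le.1 ((Complex.abs_im_le_norm ⟨p.1, p.2⟩).trans hlt.le)⟩
  refine h1.trans ?_
  rw [Measure.volume_eq_prod, ← Measure.prod_restrict, lintegral_prod _ hm.aemeasurable]

theorem setLIntegral_setLIntegral_mul_add_le {f₁ f₂ f₃ f₄ f₅ f₆ : ℝ × ℝ → ℝ≥0∞}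
    (h₁ : Measurable f₁) (h₂ : Measurable f₂) (h₃ : Measurable f₃) (h₄ : Measurable f₄)
    (h₅ : Measurable f₅) (h₆ : Measurable f₆) (c : ℝ≥0∞) (s t : Set ℝ) :
    ∫⁻ p in s, ∫⁻ q in t,
      c * (f₁ (p, q) + f₂ (p, q) + f₃ (p, q) + f₄ (p, q) + f₅ (p, q) + f₆ (p, q)) ≤
      c * ((∫⁻ p in s, ∫⁻ q in t, f₁ (p, q)) + (∫⁻ p in s, ∫⁻ q in t, f₂ (p, q)) +
        (∫⁻ p in s, ∫⁻ q in t, f₃ (p, q)) + (∫⁻ p in s, ∫⁻ q in t, f₄ (p, q)) +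
        (∫⁻ p in s, ∫⁻ q in t, f₅ (p, q)) + (∫⁻ p in s, ∫⁻ q in t, f₆ (p, q))) := by
  rw [lintegral_lintegral (f := fun p q => c * (f₁ (p, q) + f₂ (p, q) + f₃ (p, q) + f₄ (p, q) +
    f₅ (p, q) + f₆ (p, q))) (by fun_prop), ← lintegral_prod _ h₁.aemeasurable,
    ← lintegral_prod _ h₂.aemeasurable, ← lintegral_prod _ h₃.aemeasurable,
    ← lintegral_prod _ h₄.aemeasurable, ← lintegral_prod _ h₅.aemeasurable,
    ← lintegral_prod _ h₆.aemeasurable]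
  rw [lintegral_const_mul _ (by fun_prop), lintegral_add_left (by fun_prop),
      lintegral_add_left (by fun_prop), lintegral_add_left (by fun_prop),
      lintegral_add_left (by fun_prop), lintegral_add_left (by fun_prop)]

theorem exists_lintegral_convWeight_mul_le {τ : ℝ} (hτ : 0 < τ) (hτ' : τ ≤ 1 / 40) :
    ∃ C : ℝ≥0∞, C ≠ ⊤ ∧ ∀ x : ℂ, x ≠ 0 →
      ∫⁻ y, convWeight (1 + 2 * τ) y * convWeight (1 + 2 * τ) (x - y) ≤
        C * (‖x‖ₑ ^ (5 * τ))⁻¹ := by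
  obtain ⟨C₁, hC₁, H₁⟩ := exists_setLIntegral_discWeight_le (α := 1 - τ / 2) (β := 1 - τ / 2)
    (h := 0) (κ := 0) (by linarith) (by linarith) le_rfl le_rfl (by linarith) (by linarith)
  -- The choice `κ = 11τ` leaves room in both variables: `2h - κ + β = 1 - τ` and `κ / 2 + α = 1 - τ
  -- / 2`.
  obtain ⟨C₂, hC₂, H₂⟩ := exists_setLIntegral_discWeight_le (α := 1 - 6 * τ) (β := 8 * τ)
    (h := 1 / 2 + τ) (κ := 11 * τ) (by linarith) (by linarith) (by linarith) (by linarith)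
    (by linarith) (by linarith)
  obtain ⟨C₃, hC₃, H₃⟩ := exists_setLIntegral_discWeight_le (α := 4 * τ) (β := 0)
    (h := 1 - 2 * τ) (κ := 1 - 2 * τ) (by linarith) le_rfl (by linarith) le_rfl
    (by linarith) (by linarith)
  refine ⟨8 * (C₁ + C₁ + C₂ + C₂ + C₃ + C₃), by finiteness, fun x hx => ?_⟩
  have hR : 0 < ‖x‖ := norm_pos_iff.2 hx
  have hx0 : (‖x‖ : ℂ) ≠ 0 := by exact_mod_cast hR.ne'
  -- The weight is radial, so a rotation moves `x` to the positive real axis.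
  rw [← lintegral_mul_left_of_norm_eq_one (u := x / ‖x‖) _ (by
    rw [norm_div, Complex.norm_real, norm_norm, div_self hR.ne'])]
  have e : ∀ y : ℂ, x - x / ‖x‖ * y = x / ‖x‖ * (‖x‖ - y) := by intro y; field_simp
  simp only [e, convWeight_mul_of_norm_eq_one _ (u := x / ‖x‖) (by
    rw [norm_div, Complex.norm_real, norm_norm, div_self hR.ne'])]
  rw [← ofReal_norm]
  set R := ‖x‖
  rcases lt_or_ge 4 R with hR4 | hR4
  -- Two discs of radius `2` with centres more than `4` apart are disjoint.
  · refine (lintegral_mono (g := fun _ => 0) fun y => le_of_eq ?_).trans (by simp)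
    rcases lt_or_ge ‖y‖ 2 with hy | hy
    · rw [convWeight_eq_zero (z := R - y), mul_zero]
      have := norm_sub_norm_le (R : ℂ) y
      rw [Complex.norm_real, Real.norm_of_nonneg hR.le] at this
      linarith
    · rw [convWeight_eq_zero hy, zero_mul]
  have hw := measurable_convWeight (1 + 2 * τ)
  rw [lintegral_complex_eq (fun y => convWeight (1 + 2 * τ) y * convWeight (1 + 2 * τ) (R - y))
    (by fun_prop) fun z hz => by rw [convWeight_eq_zero hz, zero_mul]]
  have hm := measurable_singKernel
  refine (lintegral_mono fun p => lintegral_mono fun q =>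
    convWeight_mul_convWeight_le hτ hτ' hR hR4 ⟨p, q⟩).trans ?_
  refine (setLIntegral_setLIntegral_mul_add_le (hm _ _ _ _ _) (hm _ _ _ _ _) (hm _ _ _ _ _)
    (hm _ _ _ _ _) (hm _ _ _ _ _) (hm _ _ _ _ _) _ _ _).trans ?_
  calc _ ≤ 8 * (ENNReal.ofReal R ^ (5 * τ))⁻¹ * (C₁ + C₁ + C₂ + C₂ + C₃ + C₃) :=
        mul_le_mul_right (add_le_add (add_le_add (add_le_add (add_le_add (add_le_add
          (H₁ _ _) (H₁ _ _)) (H₂ _ _)) (H₂ _ _)) (H₃ _ _)) (H₃ _ _)) _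
    _ = _ := by ring

/-! ### Arc length in angular coordinates -/

/-- The isometry between the Euclidean plane and the complex numbers. -/
noncomputable def planeEquiv : Plane ≃ₗᵢ[ℝ] ℂ := Complex.orthonormalBasisOneI.repr.symm

/-- The arc length measure of the unit circle, as a measure on the complex plane. -/
noncomputable def circleMeasure : Measure ℂ :=
  Measure.map (fun t : ℝ => Complex.exp (t * Complex.I)) (volume.restrict (Set.Ioo (-π) π))

theorem lintegral_complex_polar (f : ℂ → ℝ≥0∞) (hf : Measurable f) :
    ∫⁻ z, f z = ∫⁻ r in Set.Ioi (0 : ℝ), ENNReal.ofReal r *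
      ∫⁻ t in Set.Ioo (-π) π, f (r * Complex.exp (t * Complex.I)) := by
  rw [← Complex.lintegral_comp_polarCoord_symm, polarCoord_target,
    Measure.volume_eq_prod, ← Measure.prod_restrict]
  have e : ∀ p : ℝ × ℝ, ENNReal.ofReal p.1 • f (Complex.polarCoord.symm p) =
      ENNReal.ofReal p.1 * f (p.1 * Complex.exp (p.2 * Complex.I)) := by
    intro p
    rw [Complex.polarCoord_symm_apply, Complex.exp_mul_I, smul_eq_mul]
    push_cast; rfl
  simp_rw [e]
  rw [lintegral_prod _ (by fun_prop)]
  refine lintegral_congr fun r => ?_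
  simp only
  rw [lintegral_const_mul _ (by fun_prop)]

theorem map_planeEquiv_arcMeasure :
    Measure.map (fun ω : UnitCircle => planeEquiv ω) arcMeasure = circleMeasure := by
  have hι : Measurable fun ω : UnitCircle => planeEquiv ω :=
    (planeEquiv.continuous.comp continuous_subtype_val).measurable
  ext s hs
  rw [Measure.map_apply hι hs, arcMeasure, Measure.toSphere_apply' _ (hι hs), circleMeasure,
    Measure.map_apply (by fun_prop) hs]
  -- `toSphere` is defined as the dimension times the volume of the cone over the set. In polar
  -- coordinates the cone contributes `∫₀¹ r dr = 1 / 2` times the measure of the angles, and the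
  -- dimension `2` cancels the half.
  have hset : Set.Ioo (0 : ℝ) 1 • ((↑) '' ((fun ω : UnitCircle => planeEquiv ω) ⁻¹' s)) =
      planeEquiv ⁻¹' {z : ℂ | (0 < ‖z‖ ∧ ‖z‖ < 1) ∧ z / ‖z‖ ∈ s} := by
    ext x
    simp only [Set.mem_smul, Set.mem_image, Set.mem_preimage, Set.mem_ofPred_eq]
    constructor
    · rintro ⟨r, hr, _, ⟨ω, hω, rfl⟩, rfl⟩
      have h1 : ‖planeEquiv (ω : Plane)‖ = 1 := by simp
      have hr0 : (r : ℂ) ≠ 0 := by exact_mod_cast hr.1.ne'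
      rw [map_smul, norm_smul, h1, mul_one, Real.norm_of_nonneg hr.1.le, Complex.real_smul,
        mul_div_cancel_left₀ _ hr0]
      exact ⟨⟨hr.1, hr.2⟩, hω⟩
    · rintro ⟨⟨h0, h1⟩, hx⟩
      refine ⟨‖planeEquiv x‖, ⟨h0, h1⟩, (‖planeEquiv x‖⁻¹ • x), ⟨⟨‖planeEquiv x‖⁻¹ • x, ?_⟩,
        ?_, rfl⟩, ?_⟩
      · rw [mem_sphere_zero_iff_norm, norm_smul, norm_inv, norm_norm,
          ← planeEquiv.norm_map x, inv_mul_cancel₀ h0.ne']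
      · simp only [map_smul, Complex.real_smul]
        rwa [Complex.ofReal_inv, mul_comm, ← div_eq_mul_inv]
      · rw [smul_smul, mul_inv_cancel₀ h0.ne', one_smul]
  have hB : MeasurableSet {z : ℂ | (0 < ‖z‖ ∧ ‖z‖ < 1) ∧ z / ‖z‖ ∈ s} := by
    refine MeasurableSet.inter (MeasurableSet.inter ?_ ?_) ?_
    · exact measurableSet_lt measurable_const measurable_norm
    · exact measurableSet_lt measurable_norm measurable_const
    · exact (by fun_prop : Measurable fun z : ℂ => z / ‖z‖) hs
  obtain ⟨B, hBdef⟩ : ∃ B : Set ℂ, B = {z : ℂ | (0 < ‖z‖ ∧ ‖z‖ < 1) ∧ z / ‖z‖ ∈ s} := ⟨_, rfl⟩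
  have hmem : ∀ z, z ∈ B ↔ (0 < ‖z‖ ∧ ‖z‖ < 1) ∧ z / ‖z‖ ∈ s := fun z => by rw [hBdef]; rfl
  rw [← hBdef] at hset hB
  rw [hset, planeEquiv.measurePreserving.measure_preimage hB.nullMeasurableSet,
    ← lintegral_indicator_one hB, lintegral_complex_polar _ (measurable_one.indicator hB)]
  have hE : MeasurableSet ((fun t : ℝ => Complex.exp (t * Complex.I)) ⁻¹' s) :=
    (by fun_prop : Measurable fun t : ℝ => Complex.exp (t * Complex.I)) hs
  have inner : ∀ r ∈ Set.Ioi (0 : ℝ), ENNReal.ofReal r * ∫⁻ t in Set.Ioo (-π) π,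
      B.indicator 1 (r * Complex.exp (t * Complex.I)) =
      (Set.Ioo (0 : ℝ) 1).indicator (fun r => ENNReal.ofReal r) r *
        (volume.restrict (Set.Ioo (-π) π))
          ((fun t : ℝ => Complex.exp (t * Complex.I)) ⁻¹' s) := by
    intro r hr
    have hr0 : (r : ℂ) ≠ 0 := by exact_mod_cast (ne_of_gt hr)
    have hn : ∀ t : ℝ, ‖(r : ℂ) * Complex.exp (t * Complex.I)‖ = r := by
      intro t
      rw [norm_mul, Complex.norm_exp_ofReal_mul_I, mul_one, Complex.norm_real,
        Real.norm_of_nonneg (le_of_lt hr)]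
    by_cases h1 : r < 1
    · rw [Set.indicator_of_mem (show r ∈ Set.Ioo (0 : ℝ) 1 from ⟨hr, h1⟩),
        ← lintegral_indicator_one hE]
      congr 1
      refine lintegral_congr fun t => ?_
      have hh : ((r : ℂ) * Complex.exp (t * Complex.I) ∈
          B) ↔
          t ∈ (fun t : ℝ => Complex.exp (t * Complex.I)) ⁻¹' s := by
        simp only [hmem, hn, Set.mem_preimage, mul_div_cancel_left₀ _ hr0]
        exact ⟨fun h => h.2, fun h => ⟨⟨hr, h1⟩, h⟩⟩
      by_cases ht : t ∈ (fun t : ℝ => Complex.exp (t * Complex.I)) ⁻¹' s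
      · rw [Set.indicator_of_mem ht, Set.indicator_of_mem (hh.2 ht)]; rfl
      · rw [Set.indicator_of_notMem ht, Set.indicator_of_notMem (mt hh.1 ht)]
    · rw [Set.indicator_of_notMem (fun h : r ∈ Set.Ioo (0 : ℝ) 1 => h1 h.2), zero_mul]
      have : ∀ t : ℝ, B.indicator
          (1 : ℂ → ℝ≥0∞) (r * Complex.exp (t * Complex.I)) = 0 := by
        intro t
        refine Set.indicator_of_notMem (fun h => h1 ?_) _
        have := ((hmem _).1 h).1.2
        rwa [hn] at this
      simp_rw [this]
      simp
  rw [setLIntegral_congr_fun measurableSet_Ioi inner,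
    lintegral_mul_const _ (Measurable.indicator (by fun_prop) measurableSet_Ioo), ← mul_assoc,
    setLIntegral_indicator measurableSet_Ioo, Set.inter_eq_left.2 Set.Ioo_subset_Ioi_self]
  have h2 : ∫⁻ r in Set.Ioo (0 : ℝ) 1, ENNReal.ofReal r = ENNReal.ofReal (1 / 2) := by
    rw [Measure.restrict_congr_set Ioo_ae_eq_Ioc, ← ofReal_integral_eq_lintegral_ofReal,
      ← intervalIntegral.integral_of_le zero_le_one, integral_id]
    · norm_num
    · exact (continuous_id.integrableOn_Icc (a := (0 : ℝ)) (b := 1)).mono_set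
        Set.Ioc_subset_Icc_self
    · filter_upwards [ae_restrict_mem measurableSet_Ioc] with r hr using hr.1.le
  rw [h2, finrank_euclideanSpace_fin, Nat.cast_ofNat, ← ENNReal.ofReal_ofNat 2,
    ← ENNReal.ofReal_mul (by norm_num)]
  norm_num

theorem setLIntegral_Ioc_add_of_periodic {g : ℝ → ℝ≥0∞} (hg : Function.Periodic g (2 * π))
    (c : ℝ) : ∫⁻ t in Set.Ioc (-π) π, g (t + c) = ∫⁻ t in Set.Ioc (-π) π, g t := by
  have h1 : ∫⁻ t in Set.Ioc (-π) π, g (t + c) = ∫⁻ t in Set.Ioc (-π + c) (π + c), g t := by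
    have := (measurePreserving_add_right volume c).setLIntegral_comp_preimage_emb
      (measurableEmbedding_addRight c) g (Set.Ioc (-π + c) (π + c))
    rw [← this]
    simp
  rw [h1]
  have d1 := isAddFundamentalDomain_Ioc Real.two_pi_pos (-π + c)
  have d2 := isAddFundamentalDomain_Ioc Real.two_pi_pos (-π)
  rw [show -π + c + 2 * π = π + c by ring] at d1
  rw [show -π + 2 * π = π by ring] at d2
  refine d1.setLIntegral_eq d2 g ?_
  rintro ⟨_, n, rfl⟩ x
  have := hg.zsmul n x
  rw [add_comm] at this
  exact this

/-! ### Pairs of points of the circle and their sum -/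

/-- One of the two points of the unit circle whose sum is `z`, depending on the sign `ε`. -/
noncomputable def halfPoint (ε : ℝ) (z : ℂ) : ℂ :=
  z / ‖z‖ * (↑(‖z‖ / 2) + ↑(ε * Real.sqrt (1 - ‖z‖ ^ 2 / 4)) * Complex.I)

theorem measurable_halfPoint (ε : ℝ) : Measurable (halfPoint ε) := by
  unfold halfPoint; fun_prop

theorem halfPoint_polar {v : ℝ} (hv : v ∈ Set.Ioo 0 π) (ε t : ℝ) :
    halfPoint ε (↑(2 * Real.cos (v / 2)) * Complex.exp (t * Complex.I)) =
      Complex.exp (t * Complex.I) *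
        (↑(Real.cos (v / 2)) + ↑(ε * Real.sin (v / 2)) * Complex.I) := by
  have hc : 0 < Real.cos (v / 2) :=
    Real.cos_pos_of_mem_Ioo ⟨by linarith [hv.1, Real.pi_pos], by linarith [hv.2]⟩
  have hs : 0 < Real.sin (v / 2) :=
    Real.sin_pos_of_pos_of_lt_pi (by linarith [hv.1]) (by linarith [hv.2, hv.1])
  have hn : ‖(↑(2 * Real.cos (v / 2)) : ℂ) * Complex.exp (t * Complex.I)‖ =
      2 * Real.cos (v / 2) := by
    rw [norm_mul, Complex.norm_exp_ofReal_mul_I, mul_one, Complex.norm_real,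
      Real.norm_of_nonneg (by positivity)]
  have h0 : (↑(2 * Real.cos (v / 2)) : ℂ) ≠ 0 := by
    exact_mod_cast (by positivity : 2 * Real.cos (v / 2) ≠ 0)
  rw [halfPoint, hn, mul_div_cancel_left₀ _ h0,
    show 1 - (2 * Real.cos (v / 2)) ^ 2 / 4 = Real.sin (v / 2) ^ 2 by
      rw [Real.sin_sq]; ring, Real.sqrt_sq hs.le,
    show 2 * Real.cos (v / 2) / 2 = Real.cos (v / 2) by ring]

/-- The product `‖z‖ √(4 - ‖z‖²)`. -/
noncomputable def chordProd (z : ℂ) : ℝ := ‖z‖ * Real.sqrt (4 - ‖z‖ ^ 2)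

theorem measurable_chordProd : Measurable chordProd := by unfold chordProd; fun_prop

/-- The image of the arc measure on pairs under addition, up to symmetry. -/
noncomputable def chordMeasure : Measure ℂ :=
  volume.withDensity fun z => ENNReal.ofReal (2 / chordProd z)

/-- In polar coordinates the density becomes `2 / √(4 - r²) dr dt`, and `r = 2 cos (v / 2)` turns it
into `dv dt`. Here `v` is the angle between the two points with sum `z`, and `t` is the direction of
`z`. -/
theorem lintegral_chordMeasure (f : ℂ → ℝ≥0∞) (hf : Measurable f) :
    ∫⁻ z, f z ∂chordMeasure = ∫⁻ v in Set.Ioo 0 π, ∫⁻ t in Set.Ioo (-π) π,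
      f (↑(2 * Real.cos (v / 2)) * Complex.exp (t * Complex.I)) := by
  have hD := measurable_chordProd
  rw [chordMeasure, lintegral_withDensity_eq_lintegral_mul _ (by fun_prop) hf,
    lintegral_complex_polar _ (by fun_prop)]
  set J : ℝ → ℝ≥0∞ := fun r =>
    ∫⁻ t in Set.Ioo (-π) π, f (r * Complex.exp (t * Complex.I)) with hJ
  have h1 : ∀ r ∈ Set.Ioi (0 : ℝ), (ENNReal.ofReal r * ∫⁻ t in Set.Ioo (-π) π,
      ((fun z => ENNReal.ofReal (2 / chordProd z)) * f) (r * Complex.exp (t * Complex.I))) =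
      (Set.Ioo (0 : ℝ) 2).indicator
        (fun r => ENNReal.ofReal (2 / Real.sqrt (4 - r ^ 2)) * J r) r := by
    intro r hr
    have hr' : 0 < r := hr
    have hD' : ∀ t : ℝ, chordProd (r * Complex.exp (t * Complex.I)) =
        r * Real.sqrt (4 - r ^ 2) := by
      intro t
      rw [chordProd, norm_mul, Complex.norm_exp_ofReal_mul_I, mul_one, Complex.norm_real,
        Real.norm_of_nonneg hr'.le]
    simp only [Pi.mul_apply, hD']
    rw [lintegral_const_mul _ (by fun_prop), ← mul_assoc, ← ENNReal.ofReal_mul hr'.le]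
    by_cases h2 : r < 2
    · rw [Set.indicator_of_mem (show r ∈ Set.Ioo (0 : ℝ) 2 from ⟨hr', h2⟩), hJ]
      congr 2
      have : 0 < Real.sqrt (4 - r ^ 2) := Real.sqrt_pos.2 (by nlinarith)
      field_simp
    · rw [Set.indicator_of_notMem (fun h : r ∈ Set.Ioo (0 : ℝ) 2 => h2 h.2),
        Real.sqrt_eq_zero_of_nonpos (by nlinarith)]
      simp
  rw [setLIntegral_congr_fun measurableSet_Ioi h1, setLIntegral_indicator measurableSet_Ioo,
    Set.inter_eq_left.2 Set.Ioo_subset_Ioi_self]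
  have hinj : Set.InjOn (fun v : ℝ => 2 * Real.cos (v / 2)) (Set.Ioo 0 π) := by
    intro a ha b hb hab
    have := Real.injOn_cos (x₁ := a / 2) (x₂ := b / 2)
      ⟨by linarith [ha.1], by linarith [ha.2, ha.1]⟩
      ⟨by linarith [hb.1], by linarith [hb.2, hb.1]⟩ (by simpa using hab)
    linarith
  have himg : (fun v : ℝ => 2 * Real.cos (v / 2)) '' Set.Ioo 0 π = Set.Ioo 0 2 := by
    ext r
    constructor
    · rintro ⟨v, hv, rfl⟩
      refine ⟨mul_pos two_pos (Real.cos_pos_of_mem_Ioo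
        ⟨by linarith [hv.1, Real.pi_pos], by linarith [hv.2]⟩), ?_⟩
      have := Real.cos_lt_cos_of_nonneg_of_le_pi le_rfl (y := v / 2)
        (by linarith [hv.2, hv.1]) (by linarith [hv.1])
      rw [Real.cos_zero] at this
      simp only; linarith
    · intro hr
      refine ⟨2 * Real.arccos (r / 2), ⟨?_, ?_⟩, ?_⟩
      · have := Real.arccos_pos.2 (by linarith [hr.2] : r / 2 < 1)
        linarith
      · have := Real.arccos_lt_pi_div_two.2 (by linarith [hr.1] : 0 < r / 2)
        linarith
      · simp only
        rw [mul_div_cancel_left₀ _ two_ne_zero, Real.cos_arccos (by linarith [hr.1])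
          (by linarith [hr.2])]
        ring
  rw [← himg, lintegral_image_eq_lintegral_abs_deriv_mul measurableSet_Ioo
    (f' := fun v => -Real.sin (v / 2)) (fun v _ => ?_) hinj]
  swap
  · have h := ((Real.hasDerivAt_cos (v / 2)).comp v ((hasDerivAt_id v).div_const 2)).const_mul 2
    refine HasDerivAt.hasDerivWithinAt (h.congr_deriv ?_)
    ring
  refine setLIntegral_congr_fun measurableSet_Ioo fun v hv => ?_
  have hs : 0 < Real.sin (v / 2) :=
    Real.sin_pos_of_pos_of_lt_pi (by linarith [hv.1]) (by linarith [hv.2, hv.1])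
  simp only [hJ]
  rw [abs_neg, abs_of_pos hs, ← mul_assoc, ← ENNReal.ofReal_mul hs.le,
    show 4 - (2 * Real.cos (v / 2)) ^ 2 = (2 * Real.sin (v / 2)) ^ 2 by
      rw [mul_pow, mul_pow, Real.sin_sq]; ring, Real.sqrt_sq (by positivity),
    show Real.sin (v / 2) * (2 / (2 * Real.sin (v / 2))) = 1 by field_simp,
    ENNReal.ofReal_one, one_mul]

theorem circleMeasure_prod_circleMeasure : circleMeasure.prod circleMeasure =
    Measure.map (fun z => (halfPoint 1 z, halfPoint (-1) z)) chordMeasure +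
      Measure.map (fun z => (halfPoint (-1) z, halfPoint 1 z)) chordMeasure := by
  have hp := measurable_halfPoint
  have he : Measurable fun t : ℝ => Complex.exp (t * Complex.I) := by fun_prop
  have : IsFiniteMeasure circleMeasure := by unfold circleMeasure; infer_instance
  refine Measure.ext_of_lintegral _ fun F hF => ?_
  rw [lintegral_add_measure, lintegral_map hF (by fun_prop), lintegral_map hF (by fun_prop),
    lintegral_chordMeasure _ (by fun_prop), lintegral_chordMeasure _ (by fun_prop),
    lintegral_prod _ hF.aemeasurable]
  set B : ℝ → ℝ → ℝ≥0∞ := fun a b =>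
    F (Complex.exp (a * Complex.I), Complex.exp (b * Complex.I)) with hB
  have hBm : Measurable (Function.uncurry B) := by
    simp only [hB, Function.uncurry_def]; fun_prop
  have hperiod : ∀ t : ℝ, Complex.exp (↑(t + 2 * π) * Complex.I) =
      Complex.exp (t * Complex.I) := by
    intro t
    push_cast
    rw [add_mul, Complex.exp_add, Complex.exp_two_pi_mul_I, mul_one]
  have e1 : ∫⁻ x, ∫⁻ y, F (x, y) ∂circleMeasure ∂circleMeasure =
      ∫⁻ a in Set.Ioc (-π) π, ∫⁻ b in Set.Ioc (-π) π, B a b := by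
    unfold circleMeasure
    rw [lintegral_map (by fun_prop) he, Measure.restrict_congr_set Ioo_ae_eq_Ioc]
    refine lintegral_congr fun a => ?_
    rw [lintegral_map (by fun_prop) he]
  -- The angles become `t - v / 2` and `t + v / 2`. Two periodic shifts, each in one variable with
  -- the other fixed, replace a planar change of variables. The sign of `v` then decides which of
  -- the two half points comes first.
  have e2 : ∫⁻ a in Set.Ioc (-π) π, ∫⁻ b in Set.Ioc (-π) π, B a b =
      ∫⁻ v in Set.Ioc (-π) π, ∫⁻ t in Set.Ioc (-π) π, B (t - v / 2) (t + v / 2) := by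
    calc _ = ∫⁻ a in Set.Ioc (-π) π, ∫⁻ v in Set.Ioc (-π) π, B a (v + a) := by
          refine lintegral_congr fun a => (setLIntegral_Ioc_add_of_periodic (g := B a) ?_ a).symm
          intro t; simp only [hB, hperiod]
      _ = ∫⁻ v in Set.Ioc (-π) π, ∫⁻ a in Set.Ioc (-π) π, B a (v + a) := by
          refine lintegral_lintegral_swap (Measurable.aemeasurable ?_)
          exact hBm.comp (by fun_prop : Measurable fun p : ℝ × ℝ => (p.1, p.2 + p.1))
      _ = _ := by
          refine lintegral_congr fun v => ?_
          rw [← setLIntegral_Ioc_add_of_periodic (g := fun a => B a (v + a)) ?_ (-(v / 2))]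
          · refine lintegral_congr fun t => ?_
            congr 1; ring
          · intro t
            simp only [hB, hperiod, ← add_assoc]
  rw [e1, e2]
  have e3 : ∀ g : ℝ → ℝ≥0∞, ∫⁻ v in Set.Ioc (-π) π, g v =
      (∫⁻ v in Set.Ioo 0 π, g (-v)) + ∫⁻ v in Set.Ioo 0 π, g v := by
    intro g
    rw [← Set.Ioc_union_Ioc_eq_Ioc (b := 0) (by linarith [Real.pi_pos]) Real.pi_pos.le,
      lintegral_union measurableSet_Ioc (by
        rw [Set.disjoint_left]; intro x h1 h2; exact absurd h1.2 (not_le.2 h2.1))]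
    rw [← Measure.restrict_congr_set (Ioo_ae_eq_Ioc (a := (0 : ℝ))),
      ← Measure.restrict_congr_set (Ioo_ae_eq_Ioc (b := (0 : ℝ)))]
    congr 1
    have := (Measure.measurePreserving_neg (volume : Measure ℝ)).setLIntegral_comp_preimage_emb
      (MeasurableEquiv.neg ℝ).measurableEmbedding g (Set.Ioo (-π) 0)
    rw [← this]
    simp
  rw [e3]
  have fin : ∀ (v t : ℝ), Complex.exp (t * Complex.I) *
        (↑(Real.cos (v / 2)) + ↑(1 * Real.sin (v / 2)) * Complex.I) =
        Complex.exp (↑(t + v / 2) * Complex.I) ∧ Complex.exp (t * Complex.I) *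
        (↑(Real.cos (v / 2)) + ↑(-1 * Real.sin (v / 2)) * Complex.I) =
        Complex.exp (↑(t - v / 2) * Complex.I) := by
    intro v t
    have h1 : ∀ w : ℝ, Complex.exp (↑(t + w) * Complex.I) = Complex.exp (t * Complex.I) *
        (↑(Real.cos w) + ↑(Real.sin w) * Complex.I) := by
      intro w
      push_cast
      rw [add_mul, Complex.exp_add, Complex.exp_mul_I (w : ℂ)]
    refine ⟨by rw [h1, one_mul], ?_⟩
    rw [sub_eq_add_neg, h1, Real.cos_neg, Real.sin_neg, neg_one_mul]
  congr 1 <;> refine setLIntegral_congr_fun measurableSet_Ioo fun v hv => ?_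
  · simp only [halfPoint_polar hv, (fin v _).1, (fin v _).2, hB]
    rw [Measure.restrict_congr_set Ioo_ae_eq_Ioc]
    refine lintegral_congr fun t => ?_
    rw [show t - -v / 2 = t + v / 2 by ring, show t + -v / 2 = t - v / 2 by ring]
  · simp only [halfPoint_polar hv, (fin v _).1, (fin v _).2, hB]
    rw [Measure.restrict_congr_set Ioo_ae_eq_Ioc]

/-! ### Weighted Hölder bounds for the two-fold density -/

/-- A measurable function on the plane that is bounded by `M` and whose restriction to the unit
circle is Lipschitz with constant `M`. -/
structure IsCircleLipschitz (M : ℝ) (g : ℂ → ℂ) : Prop where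
  measurable : Measurable g
  nonneg : 0 ≤ M
  norm_le : ∀ z, ‖g z‖ ≤ M
  norm_sub_le : ∀ z w, ‖z‖ = 1 → ‖w‖ = 1 → ‖g z - g w‖ ≤ M * ‖z - w‖

/-- The symmetrised product of two functions on the unit circle at the two points of the circle
with sum `z`. -/
noncomputable def pairProd (g₁ g₂ : ℂ → ℂ) (z : ℂ) : ℂ :=
  g₁ (halfPoint 1 z) * g₂ (halfPoint (-1) z) + g₁ (halfPoint (-1) z) * g₂ (halfPoint 1 z)

/-- The density of the convolution of two measures on the unit circle. -/
noncomputable def pairDensity (g₁ g₂ : ℂ → ℂ) (z : ℂ) : ℂ :=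
  ((2 / chordProd z : ℝ) : ℂ) * pairProd g₁ g₂ z

theorem chordProd_nonneg (z : ℂ) : 0 ≤ chordProd z := by unfold chordProd; positivity

theorem chordProd_pos_iff {z : ℂ} : 0 < chordProd z ↔ z ≠ 0 ∧ ‖z‖ < 2 := by
  constructor
  · intro h
    refine ⟨fun h0 => by simp [chordProd, h0] at h, ?_⟩
    by_contra! h2
    rw [chordProd, Real.sqrt_eq_zero_of_nonpos (by nlinarith), mul_zero] at h
    exact h.false
  · rintro ⟨h0, h2⟩
    have : 0 < ‖z‖ := norm_pos_iff.2 h0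
    exact mul_pos this (Real.sqrt_pos.2 (by nlinarith))

theorem chordProd_le_two_mul (z : ℂ) : chordProd z ≤ 2 * ‖z‖ := by
  rw [chordProd, mul_comm]
  refine mul_le_mul_of_nonneg_right ?_ (norm_nonneg z)
  rw [Real.sqrt_le_left (by norm_num)]
  nlinarith [norm_nonneg z]

theorem chordProd_le_two (z : ℂ) : chordProd z ≤ 2 := by
  rcases (chordProd_nonneg z).eq_or_lt with h | h
  · linarith
  · obtain ⟨-, h2⟩ := chordProd_pos_iff.1 h
    have hs := Real.sq_sqrt (by nlinarith [norm_nonneg z] : 0 ≤ 4 - ‖z‖ ^ 2)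
    unfold chordProd
    nlinarith [sq_nonneg (‖z‖ - Real.sqrt (4 - ‖z‖ ^ 2))]

theorem abs_sqrt_sub_sqrt_le (a b : ℝ) : |√a - √b| ≤ √|a - b| := by
  have key : ∀ a b : ℝ, √a - √b ≤ √|a - b| := by
    intro a b
    have h : √a ≤ √(b + |a - b|) := Real.sqrt_le_sqrt (by linarith [le_abs_self (a - b)])
    have h2 : √(b + |a - b|) ≤ √b + √|a - b| := by
      rw [Real.sqrt_le_left (by positivity)]
      have h3 := Real.sq_sqrt (abs_nonneg (a - b))
      have h4 := Real.sqrt_nonneg b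
      have h5 := Real.sqrt_nonneg |a - b|
      have h6 : b ≤ √b ^ 2 := by
        rcases le_total 0 b with hb | hb
        · rw [Real.sq_sqrt hb]
        · exact hb.trans (sq_nonneg _)
      nlinarith
    linarith
  rw [abs_sub_le_iff]
  refine ⟨key a b, ?_⟩
  rw [abs_sub_comm]
  exact key b a

theorem norm_halfPoint {ε : ℝ} (hε : ε ^ 2 = 1) {z : ℂ} (hz : 0 < chordProd z) :
    ‖halfPoint ε z‖ = 1 := by
  obtain ⟨h0, h2⟩ := chordProd_pos_iff.1 hz
  have h0' : ‖z‖ ≠ 0 := norm_ne_zero_iff.2 h0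
  have hs := Real.sq_sqrt (by nlinarith [norm_nonneg z] : 0 ≤ 1 - ‖z‖ ^ 2 / 4)
  rw [halfPoint, norm_mul, norm_div, Complex.norm_real, norm_norm, div_self h0', one_mul,
    Complex.norm_add_mul_I, mul_pow, hε, one_mul, hs]
  norm_num
  ring_nf

theorem halfPoint_add_halfPoint {z : ℂ} (hz : z ≠ 0) :
    halfPoint 1 z + halfPoint (-1) z = z := by
  have : (‖z‖ : ℂ) ≠ 0 := by exact_mod_cast norm_ne_zero_iff.2 hz
  unfold halfPoint
  push_cast
  field_simp
  ring

theorem norm_sub_le_two_mul_sqrt {z z' : ℂ} (hz : 0 < chordProd z) (hz' : 0 < chordProd z') :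
    ‖z - z'‖ ≤ 2 * √‖z - z'‖ := by
  have h1 := (chordProd_pos_iff.1 hz).2
  have h2 := (chordProd_pos_iff.1 hz').2
  have h3 := norm_sub_le z z'
  have h4 := Real.sq_sqrt (norm_nonneg (z - z'))
  have h5 : √‖z - z'‖ ≤ 2 := by
    rw [Real.sqrt_le_left (by norm_num)]; linarith
  nlinarith [Real.sqrt_nonneg ‖z - z'‖]

theorem abs_sq_norm_sub_sq_norm_le {z z' : ℂ} (hz : ‖z‖ ≤ 2) (hz' : ‖z'‖ ≤ 2) :
    |‖z‖ ^ 2 - ‖z'‖ ^ 2| ≤ 4 * ‖z - z'‖ := by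
  rw [sq_sub_sq, abs_mul, abs_of_nonneg (by positivity)]
  have := abs_norm_sub_norm_le z z'
  gcongr
  linarith

theorem sqrt_four_mul (x : ℝ) : √(4 * x) = 2 * √x := by
  rw [Real.sqrt_mul (by norm_num), show (4 : ℝ) = 2 ^ 2 by norm_num, Real.sqrt_sq (by norm_num)]

theorem abs_chordProd_sub_le {z z' : ℂ} (hz : 0 < chordProd z) (hz' : 0 < chordProd z') :
    |chordProd z - chordProd z'| ≤ 8 * √‖z - z'‖ := by
  have h2 := (chordProd_pos_iff.1 hz).2
  have h2' := (chordProd_pos_iff.1 hz').2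
  have hδ := norm_sub_le_two_mul_sqrt hz hz'
  have hS : |√(4 - ‖z‖ ^ 2) - √(4 - ‖z'‖ ^ 2)| ≤ 2 * √‖z - z'‖ := by
    refine (abs_sqrt_sub_sqrt_le _ _).trans ?_
    rw [← sqrt_four_mul]
    refine Real.sqrt_le_sqrt ?_
    rw [show 4 - ‖z‖ ^ 2 - (4 - ‖z'‖ ^ 2) = -(‖z‖ ^ 2 - ‖z'‖ ^ 2) by ring, abs_neg]
    exact abs_sq_norm_sub_sq_norm_le h2.le h2'.le
  have hS2 : √(4 - ‖z‖ ^ 2) ≤ 2 := by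
    rw [Real.sqrt_le_left (by norm_num)]; nlinarith [norm_nonneg z]
  calc |chordProd z - chordProd z'| = |(‖z‖ - ‖z'‖) * √(4 - ‖z‖ ^ 2) +
        ‖z'‖ * (√(4 - ‖z‖ ^ 2) - √(4 - ‖z'‖ ^ 2))| := by unfold chordProd; congr 1; ring
    _ ≤ |‖z‖ - ‖z'‖| * √(4 - ‖z‖ ^ 2) + ‖z'‖ * |√(4 - ‖z‖ ^ 2) - √(4 - ‖z'‖ ^ 2)| := by
        refine (abs_add_le _ _).trans_eq ?_
        rw [abs_mul, abs_mul, abs_of_nonneg (Real.sqrt_nonneg _), abs_of_nonneg (norm_nonneg z')]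
    _ ≤ ‖z - z'‖ * 2 + 2 * (2 * √‖z - z'‖) := by
        have := abs_norm_sub_norm_le z z'
        gcongr
    _ ≤ 8 * √‖z - z'‖ := by linarith

theorem chordProd_le_of_eq_zero {z z' : ℂ} (hz : chordProd z = 0) (hz' : 0 < chordProd z') :
    chordProd z' ≤ 8 * √‖z - z'‖ := by
  obtain ⟨h0', h2'⟩ := chordProd_pos_iff.1 hz'
  have hn : ¬ 0 < chordProd z := by rw [hz]; exact lt_irrefl 0
  rw [chordProd_pos_iff] at hn
  have hsq := Real.sq_sqrt (norm_nonneg (z - z'))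
  have hs0 := Real.sqrt_nonneg ‖z - z'‖
  by_cases hz0 : z = 0
  · subst hz0
    rw [zero_sub, norm_neg] at *
    refine (chordProd_le_two_mul z').trans ?_
    have : √‖z'‖ ≤ 2 := by rw [Real.sqrt_le_left (by norm_num)]; linarith
    nlinarith
  · have h2 : 2 ≤ ‖z‖ := by
      by_contra! h
      exact hn ⟨hz0, h⟩
    have h1 : 2 - ‖z'‖ ≤ ‖z - z'‖ := by linarith [norm_sub_norm_le z z']
    have h3 : √(4 - ‖z'‖ ^ 2) ≤ 2 * √‖z - z'‖ := by
      rw [← sqrt_four_mul]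
      refine Real.sqrt_le_sqrt ?_
      nlinarith [norm_nonneg z']
    unfold chordProd
    nlinarith [norm_nonneg z', Real.sqrt_nonneg (4 - ‖z'‖ ^ 2)]

/-- The direction `z / ‖z‖` varies at rate `2 / ‖z‖`, absorbed by `chordProd z ≤ 2 * ‖z‖`. The
height `√(1 - ‖z‖² / 4)` is only Hölder of order `1 / 2`, whence the square root. -/
theorem norm_halfPoint_sub_le {ε : ℝ} (hε : ε ^ 2 = 1) {z z' : ℂ} (hz : 0 < chordProd z)
    (hz' : 0 < chordProd z') :
    ‖halfPoint ε z - halfPoint ε z'‖ ≤ 20 * √‖z - z'‖ / chordProd z := by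
  obtain ⟨h0, h2⟩ := chordProd_pos_iff.1 hz
  obtain ⟨h0', h2'⟩ := chordProd_pos_iff.1 hz'
  have hδ := norm_sub_le_two_mul_sqrt hz hz'
  have hD := chordProd_le_two_mul z
  have hD2 := chordProd_le_two z
  set δ := ‖z - z'‖ with hδ_def
  have hs0 := Real.sqrt_nonneg δ
  have hr : 0 < ‖z‖ := norm_pos_iff.2 h0
  have hr' : 0 < ‖z'‖ := norm_pos_iff.2 h0'
  have hrc : (‖z‖ : ℂ) ≠ 0 := by exact_mod_cast hr.ne'
  have hrc' : (‖z'‖ : ℂ) ≠ 0 := by exact_mod_cast hr'.ne'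
  have hε1 : |ε| = 1 := by
    exact (sq_eq_sq₀ (abs_nonneg ε) zero_le_one).1 (by rw [sq_abs, hε, one_pow])
  set T := √(1 - ‖z‖ ^ 2 / 4)
  set T' := √(1 - ‖z'‖ ^ 2 / 4)
  have hT : |T - T'| ≤ √δ := by
    refine (abs_sqrt_sub_sqrt_le _ _).trans (Real.sqrt_le_sqrt ?_)
    have := abs_sq_norm_sub_sq_norm_le h2.le h2'.le
    rw [show 1 - ‖z‖ ^ 2 / 4 - (1 - ‖z'‖ ^ 2 / 4) = -((‖z‖ ^ 2 - ‖z'‖ ^ 2) / 4) by ring,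
      abs_neg, abs_div, abs_of_pos (by norm_num : (0 : ℝ) < 4)]
    linarith
  have hn := abs_norm_sub_norm_le z z'
  have hu : ‖z / ‖z‖ - z' / ‖z'‖‖ ≤ 2 * δ / ‖z‖ := by
    have e : z / ‖z‖ - z' / ‖z'‖ = (z - z') / ‖z‖ + z' / ‖z'‖ * ((‖z'‖ - ‖z‖ : ℝ) / ‖z‖) := by
      push_cast; field_simp; ring
    rw [e]
    refine (norm_add_le _ _).trans ?_
    rw [norm_div, norm_mul, norm_div, norm_div, Complex.norm_real, Complex.norm_real,
      Complex.norm_real, norm_norm, norm_norm, div_self hr'.ne', one_mul, ← add_div,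
      Real.norm_eq_abs, abs_sub_comm]
    gcongr
    linarith
  have hb : ‖(↑(‖z‖ / 2) + ↑(ε * T) * Complex.I : ℂ)‖ ≤ 1 := by
    have h := norm_halfPoint hε hz
    rw [halfPoint, norm_mul, norm_div, Complex.norm_real, norm_norm, div_self hr.ne',
      one_mul] at h
    exact h.le
  have hbb : ‖(↑(‖z‖ / 2) + ↑(ε * T) * Complex.I : ℂ) - (↑(‖z'‖ / 2) + ↑(ε * T') * Complex.I)‖
      ≤ δ / 2 + √δ := by
    have e : (↑(‖z‖ / 2) + ↑(ε * T) * Complex.I : ℂ) - (↑(‖z'‖ / 2) + ↑(ε * T') * Complex.I) =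
        ↑((‖z‖ - ‖z'‖) / 2) + ↑(ε * (T - T')) * Complex.I := by push_cast; ring
    rw [e]
    refine (norm_add_le _ _).trans ?_
    rw [norm_mul, Complex.norm_I, mul_one, Complex.norm_real, Complex.norm_real,
      Real.norm_eq_abs, Real.norm_eq_abs, abs_mul, hε1, one_mul, abs_div,
      abs_of_pos (by norm_num : (0 : ℝ) < 2)]
    linarith
  have e : halfPoint ε z - halfPoint ε z' =
      (z / ‖z‖ - z' / ‖z'‖) * (↑(‖z‖ / 2) + ↑(ε * T) * Complex.I) + z' / ‖z'‖ *
      ((↑(‖z‖ / 2) + ↑(ε * T) * Complex.I) - (↑(‖z'‖ / 2) + ↑(ε * T') * Complex.I)) := by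
    unfold halfPoint; ring
  rw [e, le_div_iff₀ hz]
  have hu' : ‖z / ‖z‖ - z' / ‖z'‖‖ * chordProd z ≤ 4 * δ := by
    calc _ ≤ 2 * δ / ‖z‖ * (2 * ‖z‖) := by gcongr
      _ = 4 * δ := by field_simp; ring
  calc _ ≤ (‖z / ‖z‖ - z' / ‖z'‖‖ * 1 + 1 * (δ / 2 + √δ)) * chordProd z := by
        refine mul_le_mul_of_nonneg_right ((norm_add_le _ _).trans ?_) hz.le
        rw [norm_mul, norm_mul]
        refine add_le_add (by gcongr) (mul_le_mul ?_ hbb (norm_nonneg _) zero_le_one)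
        rw [norm_div, Complex.norm_real, norm_norm, div_self hr'.ne']
    _ = ‖z / ‖z‖ - z' / ‖z'‖‖ * chordProd z + (δ / 2 + √δ) * chordProd z := by ring
    _ ≤ 4 * δ + (δ / 2 + √δ) * 2 := by gcongr
    _ ≤ 20 * √δ := by linarith

theorem norm_pairProd_le {M₁ M₂ : ℝ} {g₁ g₂ : ℂ → ℂ} (h₁ : IsCircleLipschitz M₁ g₁)
    (h₂ : IsCircleLipschitz M₂ g₂) (z : ℂ) : ‖pairProd g₁ g₂ z‖ ≤ 2 * (M₁ * M₂) := by
  have := h₁.nonneg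
  refine (norm_add_le _ _).trans ?_
  rw [norm_mul, norm_mul, two_mul]
  refine add_le_add ?_ ?_ <;>
  exact mul_le_mul (h₁.norm_le _) (h₂.norm_le _) (norm_nonneg _) this

theorem norm_pairProd_sub_le {M₁ M₂ : ℝ} {g₁ g₂ : ℂ → ℂ} (h₁ : IsCircleLipschitz M₁ g₁)
    (h₂ : IsCircleLipschitz M₂ g₂) {z z' : ℂ} (hz : 0 < chordProd z) (hz' : 0 < chordProd z') :
    ‖pairProd g₁ g₂ z - pairProd g₁ g₂ z'‖ ≤ M₁ * M₂ * (80 * √‖z - z'‖ / chordProd z) := by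
  have key : ∀ {ε η : ℝ}, ε ^ 2 = 1 → η ^ 2 = 1 →
      ‖g₁ (halfPoint ε z) * g₂ (halfPoint η z) - g₁ (halfPoint ε z') * g₂ (halfPoint η z')‖ ≤
        M₁ * M₂ * (40 * √‖z - z'‖ / chordProd z) := by
    intro ε η hε hη
    have hM := h₁.nonneg
    have hM2 := h₂.nonneg
    have a1 := (h₁.norm_sub_le _ _ (norm_halfPoint hε hz) (norm_halfPoint hε hz')).trans
      (mul_le_mul_of_nonneg_left (norm_halfPoint_sub_le hε hz hz') hM)
    have a2 := (h₂.norm_sub_le _ _ (norm_halfPoint hη hz) (norm_halfPoint hη hz')).trans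
      (mul_le_mul_of_nonneg_left (norm_halfPoint_sub_le hη hz hz') hM2)
    have b1 := h₁.norm_le (halfPoint ε z')
    have b2 := h₂.norm_le (halfPoint η z)
    calc _ = ‖(g₁ (halfPoint ε z) - g₁ (halfPoint ε z')) * g₂ (halfPoint η z) +
          g₁ (halfPoint ε z') * (g₂ (halfPoint η z) - g₂ (halfPoint η z'))‖ := by
          congr 1; ring
      _ ≤ M₁ * (20 * √‖z - z'‖ / chordProd z) * M₂ +
          M₁ * (M₂ * (20 * √‖z - z'‖ / chordProd z)) := by
          refine (norm_add_le _ _).trans ?_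
          rw [norm_mul, norm_mul]
          gcongr
      _ = _ := by ring
  unfold pairProd
  rw [add_sub_add_comm]
  refine (norm_add_le _ _).trans ((add_le_add (key (by norm_num) (by norm_num))
    (key (by norm_num) (by norm_num))).trans_eq ?_)
  ring

theorem min_one_le_rpow {t b : ℝ} (ht : 0 ≤ t) (hb : 0 ≤ b) (hb1 : b ≤ 1) :
    min 1 t ≤ t ^ b := by
  rcases le_total t 1 with h | h
  · exact (min_le_right _ _).trans (Real.self_le_rpow_of_le_one ht h hb1)
  · exact (min_le_left _ _).trans (Real.one_le_rpow h hb)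

/-- Interpolation: `min 1 t ≤ t ^ (2τ)` turns modulus `√δ / D` into `δ^τ D^(-2τ)`, and the amplitude
`1 / D` raises the exponent of `D` to `1 + 2τ`. -/
theorem min_one_div_le {τ D δ : ℝ} (hτ : 0 ≤ τ) (hτ' : 2 * τ ≤ 1) (hD : 0 < D) (hδ : 0 ≤ δ) :
    1 / D * min 1 (80 * √δ / D) ≤ 80 * δ ^ τ * D ^ (-(1 + 2 * τ)) := by
  have h1 : (80 * √δ / D) ^ (2 * τ) ≤ 80 * δ ^ τ * D ^ (-(2 * τ)) := by
    rw [Real.div_rpow (by positivity) hD.le, Real.mul_rpow (by norm_num) (Real.sqrt_nonneg _),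
      Real.sqrt_eq_rpow, ← Real.rpow_mul hδ, show 1 / 2 * (2 * τ) = τ by ring,
      Real.rpow_neg hD.le, div_eq_mul_inv]
    gcongr
    exact Real.rpow_le_self_of_one_le (by norm_num) hτ'
  calc 1 / D * min 1 (80 * √δ / D) ≤ D ^ (-1 : ℝ) * (80 * δ ^ τ * D ^ (-(2 * τ))) := by
        rw [Real.rpow_neg_one, one_div]
        gcongr
        exact (min_one_le_rpow (by positivity) (by linarith) hτ').trans h1
    _ = 80 * δ ^ τ * (D ^ (-1 : ℝ) * D ^ (-(2 * τ))) := by ring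
    _ = _ := by rw [← Real.rpow_add hD]; congr 2; ring

theorem norm_pairDensity_le {M₁ M₂ : ℝ} {g₁ g₂ : ℂ → ℂ} (h₁ : IsCircleLipschitz M₁ g₁)
    (h₂ : IsCircleLipschitz M₂ g₂) (z : ℂ) :
    ‖pairDensity g₁ g₂ z‖ ≤ 4 * (M₁ * M₂) * (1 / chordProd z) := by
  rcases (chordProd_nonneg z).eq_or_lt with h | h
  · simp [pairDensity, ← h]
  · rw [pairDensity, norm_mul, Complex.norm_real, Real.norm_of_nonneg (by positivity)]
    calc _ ≤ 2 / chordProd z * (2 * (M₁ * M₂)) := by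
          gcongr; exact norm_pairProd_le h₁ h₂ z
      _ = _ := by ring

theorem norm_pairDensity_sub_le {τ M₁ M₂ : ℝ} (hτ : 0 < τ) (hτ' : 2 * τ ≤ 1) {g₁ g₂ : ℂ → ℂ}
    (h₁ : IsCircleLipschitz M₁ g₁) (h₂ : IsCircleLipschitz M₂ g₂) (z z' : ℂ) :
    ‖pairDensity g₁ g₂ z - pairDensity g₁ g₂ z'‖ ≤ 1000 * (M₁ * M₂) * ‖z - z'‖ ^ τ *
      (chordProd z ^ (-(1 + 2 * τ)) + chordProd z' ^ (-(1 + 2 * τ))) := by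
  wlog hle : chordProd z ≤ chordProd z' generalizing z z'
  · rw [norm_sub_rev, norm_sub_rev z z', add_comm]
    exact this z' z (le_of_not_ge hle)
  have hM : 0 ≤ M₁ * M₂ := mul_nonneg h₁.nonneg h₂.nonneg
  have r1 : 0 ≤ chordProd z ^ (-(1 + 2 * τ)) := Real.rpow_nonneg (chordProd_nonneg z) _
  have r2 : 0 ≤ chordProd z' ^ (-(1 + 2 * τ)) := Real.rpow_nonneg (chordProd_nonneg z') _
  have r3 : 0 ≤ ‖z - z'‖ ^ τ := by positivity
  rcases (chordProd_nonneg z').eq_or_lt with h' | h'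
  · have h : chordProd z = 0 := le_antisymm (h' ▸ hle) (chordProd_nonneg z)
    have : pairDensity g₁ g₂ z - pairDensity g₁ g₂ z' = 0 := by simp [pairDensity, h, ← h']
    rw [this, norm_zero]
    positivity
  rcases (chordProd_nonneg z).eq_or_lt with h | h
  · have h0 : pairDensity g₁ g₂ z = 0 := by simp [pairDensity, ← h]
    rw [h0, zero_sub, norm_neg]
    -- When `chordProd z` vanishes, so do `pairDensity` at `z` and, by the conventions for real
    -- powers, the `z` term on the right. But then `z'` is so close to the degenerate set, relative
    -- to `‖z - z'‖`, that its size bound alone suffices.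
    have hmin : min 1 (80 * √‖z - z'‖ / chordProd z') = 1 := by
      refine min_eq_left ?_
      rw [le_div_iff₀ h']
      have := chordProd_le_of_eq_zero h.symm h'
      linarith [Real.sqrt_nonneg ‖z - z'‖]
    have hk := min_one_div_le hτ.le hτ' h' (norm_nonneg (z - z'))
    rw [hmin, mul_one] at hk
    calc _ ≤ 4 * (M₁ * M₂) * (80 * ‖z - z'‖ ^ τ * chordProd z' ^ (-(1 + 2 * τ))) :=
          (norm_pairDensity_le h₁ h₂ z').trans (by gcongr)
      _ = 320 * (M₁ * M₂) * ‖z - z'‖ ^ τ * (0 + chordProd z' ^ (-(1 + 2 * τ))) := by ring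
      _ ≤ _ := by gcongr; norm_num
  · have hk := min_one_div_le hτ.le hτ' h (norm_nonneg (z - z'))
    set m := min 1 (80 * √‖z - z'‖ / chordProd z) with hm
    have ha : ‖pairProd g₁ g₂ z - pairProd g₁ g₂ z'‖ ≤ 4 * (M₁ * M₂) * m := by
      have e1 := norm_pairProd_sub_le h₁ h₂ h h'
      have e2 := (norm_sub_le (pairProd g₁ g₂ z) (pairProd g₁ g₂ z')).trans
        (add_le_add (norm_pairProd_le h₁ h₂ z) (norm_pairProd_le h₁ h₂ z'))
      rw [hm, mul_min_of_nonneg _ _ (by positivity)]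
      refine le_min (by linarith) (e1.trans ?_)
      have : 0 ≤ 80 * √‖z - z'‖ / chordProd z := by positivity
      nlinarith [mul_nonneg hM this]
    -- The reduction to `chordProd z ≤ chordProd z'` allows the denominator `chordProd z'` to be
    -- replaced by `chordProd z`.
    have hd : |2 / chordProd z - 2 / chordProd z'| ≤ 2 / chordProd z * m := by
      have e : 2 / chordProd z - 2 / chordProd z' =
          2 / chordProd z * ((chordProd z' - chordProd z) / chordProd z') := by
        field_simp
      rw [e, abs_mul, abs_of_pos (by positivity), abs_of_nonneg
        (div_nonneg (by linarith) h'.le)]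
      gcongr
      refine le_min ?_ ?_
      · rw [div_le_one h']; linarith
      · have := abs_chordProd_sub_le h h'
        rw [abs_sub_comm, abs_of_nonneg (by linarith)] at this
        gcongr
        linarith [Real.sqrt_nonneg ‖z - z'‖]
    have hpp := norm_pairProd_le h₁ h₂ z'
    calc ‖pairDensity g₁ g₂ z - pairDensity g₁ g₂ z'‖
        = ‖((2 / chordProd z : ℝ) : ℂ) * (pairProd g₁ g₂ z - pairProd g₁ g₂ z') +
          ((2 / chordProd z - 2 / chordProd z' : ℝ) : ℂ) * pairProd g₁ g₂ z'‖ := by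
          unfold pairDensity; congr 1; push_cast; ring
      _ ≤ 2 / chordProd z * (4 * (M₁ * M₂) * m) +
          2 / chordProd z * m * (2 * (M₁ * M₂)) := by
          refine (norm_add_le _ _).trans ?_
          rw [norm_mul, norm_mul, Complex.norm_real, Complex.norm_real,
            Real.norm_of_nonneg (by positivity), Real.norm_eq_abs]
          gcongr
      _ = 12 * (M₁ * M₂) * (1 / chordProd z * m) := by ring
      _ ≤ 12 * (M₁ * M₂) * (80 * ‖z - z'‖ ^ τ * chordProd z ^ (-(1 + 2 * τ))) := by gcongr
      _ = 960 * (M₁ * M₂) * ‖z - z'‖ ^ τ * (chordProd z ^ (-(1 + 2 * τ)) + 0) := by ring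
      _ ≤ _ := by gcongr; norm_num

theorem ofReal_chordProd_rpow_le {s : ℝ} (hs : 0 < s) (z : ℂ) :
    ENNReal.ofReal (chordProd z ^ (-s)) ≤ convWeight s z := by
  rcases (chordProd_nonneg z).eq_or_lt with h | h
  · rw [← h, Real.zero_rpow (by linarith), ENNReal.ofReal_zero]; exact zero_le
  · obtain ⟨h0, h2⟩ := chordProd_pos_iff.1 h
    have hr : 0 < ‖z‖ := norm_pos_iff.2 h0
    have h4 : 0 < 4 - ‖z‖ ^ 2 := by nlinarith
    rw [convWeight, if_pos h2, ← ENNReal.ofReal_rpow_of_pos h, ENNReal.rpow_neg, chordProd,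
      ENNReal.ofReal_mul hr.le, ENNReal.mul_rpow_of_nonneg _ _ hs.le, ofReal_norm,
      ENNReal.mul_inv (Or.inr (ENNReal.rpow_ne_top_of_nonneg hs.le ENNReal.ofReal_ne_top))
        (Or.inl (ENNReal.rpow_ne_top_of_nonneg hs.le enorm_ne_top)),
      Real.sqrt_eq_rpow, ← ENNReal.ofReal_rpow_of_pos h4, ← ENNReal.rpow_mul,
      show 1 / 2 * s = s / 2 by ring]

theorem enorm_pairDensity_sub_le {τ M₁ M₂ : ℝ} (hτ : 0 < τ) (hτ' : 2 * τ ≤ 1) {g₁ g₂ : ℂ → ℂ}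
    (h₁ : IsCircleLipschitz M₁ g₁) (h₂ : IsCircleLipschitz M₂ g₂) (z z' : ℂ) :
    ‖pairDensity g₁ g₂ z - pairDensity g₁ g₂ z'‖ₑ ≤
      ENNReal.ofReal (1000 * (M₁ * M₂) * ‖z - z'‖ ^ τ) *
        (convWeight (1 + 2 * τ) z + convWeight (1 + 2 * τ) z') := by
  have hM : 0 ≤ M₁ * M₂ := mul_nonneg h₁.nonneg h₂.nonneg
  rw [← ofReal_norm]
  refine (ENNReal.ofReal_le_ofReal (norm_pairDensity_sub_le hτ hτ' h₁ h₂ z z')).trans ?_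
  rw [ENNReal.ofReal_mul (by positivity),
    ENNReal.ofReal_add (Real.rpow_nonneg (chordProd_nonneg z) _)
      (Real.rpow_nonneg (chordProd_nonneg z') _)]
  gcongr <;> exact ofReal_chordProd_rpow_le (by linarith) _

theorem enorm_pairDensity_le {τ M₁ M₂ : ℝ} (hτ : 0 < τ) (hτ' : 2 * τ ≤ 1) {g₁ g₂ : ℂ → ℂ}
    (h₁ : IsCircleLipschitz M₁ g₁) (h₂ : IsCircleLipschitz M₂ g₂) (z : ℂ) :
    ‖pairDensity g₁ g₂ z‖ₑ ≤ ENNReal.ofReal (8 * (M₁ * M₂)) * convWeight (1 + 2 * τ) z := by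
  have hM : 0 ≤ M₁ * M₂ := mul_nonneg h₁.nonneg h₂.nonneg
  rw [← ofReal_norm]
  refine (ENNReal.ofReal_le_ofReal ((norm_pairDensity_le h₁ h₂ z).trans
    (c := 8 * (M₁ * M₂) * chordProd z ^ (-(1 + 2 * τ))) ?_)).trans ?_
  · rcases (chordProd_nonneg z).eq_or_lt with h | h
    · rw [← h, Real.zero_rpow (by linarith)]; simp
    · have h1 : 1 / chordProd z = chordProd z ^ (-(1 + 2 * τ)) * chordProd z ^ (2 * τ) := by
        rw [← Real.rpow_add h, one_div, ← Real.rpow_neg_one]; congr 1; ring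
      have h2 : chordProd z ^ (2 * τ) ≤ 2 := by
        calc chordProd z ^ (2 * τ) ≤ 2 ^ (2 * τ) :=
              Real.rpow_le_rpow h.le (chordProd_le_two z) (by linarith)
          _ ≤ 2 := Real.rpow_le_self_of_one_le (by norm_num) hτ'
      rw [h1]
      calc _ ≤ 4 * (M₁ * M₂) * (chordProd z ^ (-(1 + 2 * τ)) * 2) := by gcongr
        _ = _ := by ring
  · rw [ENNReal.ofReal_mul (by positivity)]
    gcongr
    exact ofReal_chordProd_rpow_le (by linarith) _

theorem IsCircleLipschitz.measurable_pairDensity {M₁ M₂ : ℝ} {g₁ g₂ : ℂ → ℂ}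
    (h₁ : IsCircleLipschitz M₁ g₁) (h₂ : IsCircleLipschitz M₂ g₂) :
    Measurable (pairDensity g₁ g₂) := by
  have m₁ := h₁.measurable
  have m₂ := h₂.measurable
  have hp := measurable_halfPoint
  have hD := measurable_chordProd
  unfold pairDensity pairProd
  fun_prop

/-! ### Two-fold convolutions as integrals against the density -/

instance : IsFiniteMeasure circleMeasure := by unfold circleMeasure; infer_instance

instance : IsFiniteMeasure chordMeasure := by
  constructor
  rw [← lintegral_one, lintegral_chordMeasure (fun _ => 1) measurable_const]
  simp only [lintegral_one, lintegral_const, Measure.restrict_apply_univ,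
    Real.volume_Ioo]
  exact ENNReal.mul_lt_top ENNReal.ofReal_lt_top ENNReal.ofReal_lt_top

theorem integral_chordMeasure (F : ℂ → ℂ) :
    ∫ z, F z ∂chordMeasure = ∫ z, ((2 / chordProd z : ℝ) : ℂ) * F z := by
  have hD := measurable_chordProd
  rw [chordMeasure, integral_withDensity_eq_integral_toReal_smul (by fun_prop)
    (Filter.Eventually.of_forall fun _ => ENNReal.ofReal_lt_top)]
  refine integral_congr_ae (Filter.Eventually.of_forall fun z => ?_)
  simp only
  rw [ENNReal.toReal_ofReal (div_nonneg zero_le_two (chordProd_nonneg z)), Complex.real_smul]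

theorem integrable_of_chordMeasure {F : ℂ → ℂ} (hF : Integrable F chordMeasure) :
    Integrable fun z => ((2 / chordProd z : ℝ) : ℂ) * F z := by
  have hD := measurable_chordProd
  rw [chordMeasure, integrable_withDensity_iff_integrable_smul' (by fun_prop)
    (Filter.Eventually.of_forall fun _ => ENNReal.ofReal_lt_top)] at hF
  refine hF.congr (Filter.Eventually.of_forall fun z => ?_)
  simp only
  rw [ENNReal.toReal_ofReal (div_nonneg zero_le_two (chordProd_nonneg z)), Complex.real_smul]

theorem integrable_pairDensity {M₁ M₂ : ℝ} {g₁ g₂ : ℂ → ℂ}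
    (h₁ : IsCircleLipschitz M₁ g₁) (h₂ : IsCircleLipschitz M₂ g₂) :
    Integrable (pairDensity g₁ g₂) := by
  have m₁ := h₁.measurable
  have m₂ := h₂.measurable
  have hp := measurable_halfPoint
  refine integrable_of_chordMeasure (F := pairProd g₁ g₂) ?_
  refine Integrable.of_bound (C := 2 * (M₁ * M₂)) ?_ ?_
  · unfold pairProd
    exact Measurable.aestronglyMeasurable (by fun_prop)
  · exact Filter.Eventually.of_forall fun z => norm_pairProd_le h₁ h₂ z

theorem integral_circleMeasure_prod {M₁ M₂ B : ℝ} {g₁ g₂ φ : ℂ → ℂ}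
    (h₁ : IsCircleLipschitz M₁ g₁) (h₂ : IsCircleLipschitz M₂ g₂) (hφ : Measurable φ)
    (hB : ∀ z, ‖φ z‖ ≤ B) :
    ∫ p, φ (p.1 + p.2) * (g₁ p.1 * g₂ p.2) ∂(circleMeasure.prod circleMeasure) =
      ∫ z, φ z * pairDensity g₁ g₂ z := by
  have m₁ := h₁.measurable
  have m₂ := h₂.measurable
  have hp := measurable_halfPoint
  have hm : Measurable fun p : ℂ × ℂ => φ (p.1 + p.2) * (g₁ p.1 * g₂ p.2) := by fun_prop
  have hb : ∀ p : ℂ × ℂ, ‖φ (p.1 + p.2) * (g₁ p.1 * g₂ p.2)‖ ≤ B * (M₁ * M₂) := by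
    intro p
    rw [norm_mul, norm_mul]
    have := h₁.nonneg
    have := h₂.nonneg
    have := (norm_nonneg _).trans (hB (p.1 + p.2))
    gcongr
    exacts [hB _, h₁.norm_le _, h₂.norm_le _]
  have hi : ∀ (μ : Measure (ℂ × ℂ)) [IsFiniteMeasure μ],
      Integrable (fun p : ℂ × ℂ => φ (p.1 + p.2) * (g₁ p.1 * g₂ p.2)) μ := fun μ _ =>
    Integrable.of_bound hm.aestronglyMeasurable _ (Filter.Eventually.of_forall hb)
  have hi' : ∀ ε η, Integrable (fun z => φ (halfPoint ε z + halfPoint η z) *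
      (g₁ (halfPoint ε z) * g₂ (halfPoint η z))) chordMeasure := fun ε η =>
    Integrable.of_bound (Measurable.aestronglyMeasurable (by fun_prop)) _
      (Filter.Eventually.of_forall fun z => hb (halfPoint ε z, halfPoint η z))
  rw [circleMeasure_prod_circleMeasure, integral_add_measure (hi _) (hi _),
    integral_map (by fun_prop) hm.aestronglyMeasurable,
    integral_map (by fun_prop) hm.aestronglyMeasurable, ← integral_add (hi' _ _) (hi' _ _),
    integral_chordMeasure]
  refine integral_congr_ae (Filter.Eventually.of_forall fun z => ?_)
  simp only [pairDensity, pairProd]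
  -- At the origin the half points do not sum to `z` under these formulas, but `2 / chordProd 0` is
  -- `0`.
  rcases eq_or_ne z 0 with rfl | hz
  · simp [chordProd]
  · rw [add_comm (halfPoint (-1) z), halfPoint_add_halfPoint hz]; ring

/-! ### Transport of functions from the unit circle -/

/-- The extension by zero of a function on the unit circle to the complex plane. -/
noncomputable def circleExtend (h : UnitCircle → ℂ) : ℂ → ℂ :=
  Function.extend (fun ω : UnitCircle => planeEquiv ω) h 0

theorem injective_planeEquiv_coe :
    Function.Injective fun ω : UnitCircle => planeEquiv (ω : Plane) :=
  planeEquiv.injective.comp Subtype.val_injective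

theorem measurableEmbedding_planeEquiv_coe :
    MeasurableEmbedding fun ω : UnitCircle => planeEquiv (ω : Plane) :=
  planeEquiv.toHomeomorph.measurableEmbedding.comp
    (MeasurableEmbedding.subtype_coe Metric.isClosed_sphere.measurableSet)

theorem circleExtend_apply (h : UnitCircle → ℂ) (ω : UnitCircle) :
    circleExtend h (planeEquiv ω) = h ω :=
  injective_planeEquiv_coe.extend_apply h 0 ω

theorem lipNorm_nonneg (h : UnitCircle → ℂ) : 0 ≤ lipNorm h :=
  add_nonneg (Real.iSup_nonneg fun _ => norm_nonneg _)
    (Real.iSup_nonneg fun _ => div_nonneg (norm_nonneg _) dist_nonneg)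

/-- The Lipschitz hypothesis ensures that both real suprema in `lipNorm` are over bounded families;
`K` does not enter the constant, which is what makes the final bound depend on `lipNorm` alone. The
extension is discontinuous off the circle, which is harmless because nondegenerate half points lie
on it. -/
theorem isCircleLipschitz_circleExtend {h : UnitCircle → ℂ} {K : NNReal}
    (hh : LipschitzWith K h) : IsCircleLipschitz (lipNorm h) (circleExtend h) := by
  have s1 : 0 ≤ ⨆ ω : UnitCircle, ‖h ω‖ := Real.iSup_nonneg fun _ => norm_nonneg _
  have s2 : 0 ≤ ⨆ p : {p : UnitCircle × UnitCircle // p.1 ≠ p.2},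
      ‖h p.1.1 - h p.1.2‖ / dist p.1.1 p.1.2 :=
    Real.iSup_nonneg fun _ => div_nonneg (norm_nonneg _) dist_nonneg
  have hsurj : ∀ z : ℂ, ‖z‖ = 1 → ∃ ω : UnitCircle, planeEquiv (ω : Plane) = z := by
    intro z hz
    refine ⟨⟨planeEquiv.symm z, by rw [mem_sphere_zero_iff_norm, LinearIsometryEquiv.norm_map, hz]⟩,
      planeEquiv.apply_symm_apply z⟩
  refine ⟨measurableEmbedding_planeEquiv_coe.measurable_extend hh.continuous.measurable
    measurable_const, lipNorm_nonneg h, fun z => ?_, fun z w hz hw => ?_⟩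
  · by_cases hz : ∃ ω : UnitCircle, planeEquiv (ω : Plane) = z
    · obtain ⟨ω, rfl⟩ := hz
      rw [circleExtend_apply]
      refine (le_ciSup (f := fun ω : UnitCircle => ‖h ω‖) ?_ ω).trans (le_add_of_nonneg_right s2)
      exact (isCompact_range hh.continuous.norm).bddAbove
    · rw [circleExtend, Function.extend_apply' _ _ _ hz]
      simpa using lipNorm_nonneg h
  · obtain ⟨ω, rfl⟩ := hsurj z hz
    obtain ⟨ω', rfl⟩ := hsurj w hw
    rw [circleExtend_apply, circleExtend_apply, ← dist_eq_norm (planeEquiv _),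
      planeEquiv.dist_map, ← Subtype.dist_eq]
    rcases eq_or_ne ω ω' with rfl | hne
    · simp
    rw [← div_le_iff₀ (dist_pos.2 hne)]
    refine (le_ciSup (f := fun p : {p : UnitCircle × UnitCircle // p.1 ≠ p.2} =>
      ‖h p.1.1 - h p.1.2‖ / dist p.1.1 p.1.2) ?_ ⟨(ω, ω'), hne⟩).trans
      (le_add_of_nonneg_left s1)
    refine ⟨K, ?_⟩
    rintro _ ⟨p, rfl⟩
    simp only
    rw [div_le_iff₀ (dist_pos.2 p.2), ← dist_eq_norm]
    exact hh.dist_le_mul _ _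

theorem integral_arcMeasure_prod {h₁ h₂ : UnitCircle → ℂ} {K₁ K₂ : NNReal} {B : ℝ}
    (hh₁ : LipschitzWith K₁ h₁) (hh₂ : LipschitzWith K₂ h₂) {φ : ℂ → ℂ} (hφ : Measurable φ)
    (hB : ∀ z, ‖φ z‖ ≤ B) :
    ∫ p : UnitCircle × UnitCircle, φ (planeEquiv p.1 + planeEquiv p.2) * (h₁ p.1 * h₂ p.2)
        ∂(arcMeasure.prod arcMeasure) =
      ∫ z, φ z * pairDensity (circleExtend h₁) (circleExtend h₂) z := by
  have hι := measurableEmbedding_planeEquiv_coe.measurable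
  have i₁ := isCircleLipschitz_circleExtend hh₁
  have i₂ := isCircleLipschitz_circleExtend hh₂
  have m₁ := i₁.measurable
  have m₂ := i₂.measurable
  rw [← integral_circleMeasure_prod i₁ i₂ hφ hB, ← map_planeEquiv_arcMeasure,
    Measure.map_prod_map _ _ hι hι, integral_map (by fun_prop)
      (Measurable.aestronglyMeasurable (by fun_prop))]
  simp only [Prod.map_fst, Prod.map_snd, circleExtend_apply]

/-! ### The density of the four-fold convolution -/

/-- The density of the four-fold convolution, transported to the complex plane. -/
noncomputable def quadDensity (g : Fin 4 → ℂ → ℂ) (x : ℂ) : ℂ :=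
  ∫ y, pairDensity (g 0) (g 1) y * pairDensity (g 2) (g 3) (x - y)

theorem integrable_mul_comp_sub {f k : ℂ → ℂ} (hf : Integrable f) (hk : Integrable k) :
    Integrable (fun p : ℂ × ℂ => f p.2 * k (p.1 - p.2)) (volume.prod volume) :=
  hf.convolution_integrand (ContinuousLinearMap.mul ℝ ℂ) hk

theorem integrable_quadDensity {M : Fin 4 → ℝ} {g : Fin 4 → ℂ → ℂ}
    (hg : ∀ j, IsCircleLipschitz (M j) (g j)) : Integrable (quadDensity g) :=
  (integrable_mul_comp_sub (integrable_pairDensity (hg 0) (hg 1))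
    (integrable_pairDensity (hg 2) (hg 3))).integral_prod_left

theorem integral_integral_mul_eq {f k φ : ℂ → ℂ} (hf : Integrable f) (hk : Integrable k)
    (hφ : Measurable φ) {B : ℝ} (hB : ∀ z, ‖φ z‖ ≤ B) :
    ∫ y, (∫ z, φ (y + z) * k z) * f y = ∫ x, φ x * ∫ y, f y * k (x - y) := by
  calc ∫ y, (∫ z, φ (y + z) * k z) * f y
      = ∫ y, ∫ x, φ x * (f y * k (x - y)) := by
        refine integral_congr_ae (Filter.Eventually.of_forall fun y => ?_)
        simp only
        rw [← integral_add_left_eq_self (fun x => φ x * (f y * k (x - y))) y,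
          ← integral_mul_const]
        refine integral_congr_ae (Filter.Eventually.of_forall fun z => ?_)
        simp only
        rw [add_sub_cancel_left]; ring
    _ = ∫ x, ∫ y, φ x * (f y * k (x - y)) := by
        refine (integral_integral_swap (f := fun x y => φ x * (f y * k (x - y))) ?_).symm
        exact (integrable_mul_comp_sub hf hk).bdd_mul (c := B)
          (f := fun p : ℂ × ℂ => φ p.1)
          (Measurable.aestronglyMeasurable (by fun_prop))
          (Filter.Eventually.of_forall fun p => hB p.1)
    _ = _ := by
        refine integral_congr_ae (Filter.Eventually.of_forall fun x => ?_)
        exact integral_const_mul _ _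

theorem fourConv_eq_withDensity {h : Fin 4 → UnitCircle → ℂ}
    (hh : ∀ j, ∃ K : NNReal, LipschitzWith K (h j)) :
    fourConv h = (volume : Measure Plane).withDensityᵥ
      (fun x => quadDensity (fun j => circleExtend (h j)) (planeEquiv x)) := by
  choose K hK using hh
  have hg := fun j => isCircleLipschitz_circleExtend (hK j)
  have hI := integrable_quadDensity hg
  have hintg := fun j => integrable_of_lipschitz (hK j)
  have hmeas : ∀ j, Measurable (h j) := fun j => (hK j).continuous.measurable
  have hι := measurableEmbedding_planeEquiv_coe.measurable
  have hem : MeasurableEmbedding planeEquiv := planeEquiv.toHomeomorph.measurableEmbedding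
  have hI' : Integrable (fun x => quadDensity (fun j => circleExtend (h j)) (planeEquiv x)) :=
    (planeEquiv.measurePreserving.integrable_comp_emb hem).2 hI
  ext E hE
  set S : Set ℂ := planeEquiv.symm ⁻¹' E with hS_def
  have hS : MeasurableSet S := planeEquiv.symm.continuous.measurable hE
  set χ : ℂ → ℂ := S.indicator 1 with hχ_def
  have hχ : Measurable χ := measurable_one.indicator hS
  have hχB : ∀ z, ‖χ z‖ ≤ 1 := by
    intro z
    by_cases hz : z ∈ S <;> simp [hχ_def, hz]
  have hχE : ∀ x : Plane, χ (planeEquiv x) = E.indicator 1 x := by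
    intro x
    by_cases hx : x ∈ E <;> simp [hχ_def, hS_def, hx]
  set f := pairDensity (circleExtend (h 0)) (circleExtend (h 1))
  set k := pairDensity (circleExtend (h 2)) (circleExtend (h 3))
  have hf : Integrable f := integrable_pairDensity (hg 0) (hg 1)
  have hk : Integrable k := integrable_pairDensity (hg 2) (hg 3)
  have hkm : Measurable k := (hg 2).measurable_pairDensity (hg 3)
  -- `ψ` is the result of integrating out the last two circle variables. It is bounded and
  -- measurable, so it can serve as test function for the first two.
  set ψ : ℂ → ℂ := fun w => ∫ z, χ (w + z) * k z with hψ_def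
  have hψ : Measurable ψ := by
    have : StronglyMeasurable fun p : ℂ × ℂ => χ (p.1 + p.2) * k p.2 :=
      Measurable.stronglyMeasurable (by fun_prop)
    exact this.integral_prod_right'.measurable
  have hψB : ∀ w, ‖ψ w‖ ≤ ∫ z, ‖k z‖ := by
    intro w
    refine (norm_integral_le_integral_norm _).trans ?_
    refine integral_mono_of_nonneg (Filter.Eventually.of_forall fun _ => norm_nonneg _) hk.norm
      (Filter.Eventually.of_forall fun z => ?_)
    simp only [norm_mul]
    exact mul_le_of_le_one_left (norm_nonneg _) (hχB _)
  have hm4 : Measurable fun p : ((UnitCircle × UnitCircle) × UnitCircle) × UnitCircle =>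
      (p.1.1.1 : Plane) + p.1.1.2 + p.1.2 + p.2 := by fun_prop
  have hint4 : Integrable (fun p : ((UnitCircle × UnitCircle) × UnitCircle) × UnitCircle =>
      h 0 p.1.1.1 * h 1 p.1.1.2 * h 2 p.1.2 * h 3 p.2)
      (((arcMeasure.prod arcMeasure).prod arcMeasure).prod arcMeasure) :=
    (((hintg 0).mul_prod (hintg 1)).mul_prod (hintg 2)).mul_prod (hintg 3)
  set Ψ : (UnitCircle × UnitCircle) × UnitCircle × UnitCircle → ℂ := fun q =>
    χ (planeEquiv q.1.1 + planeEquiv q.1.2 + (planeEquiv q.2.1 + planeEquiv q.2.2)) *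
      (h 2 q.2.1 * h 3 q.2.2) * (h 0 q.1.1 * h 1 q.1.2) with hΨ_def
  have hΨ : Integrable Ψ ((arcMeasure.prod arcMeasure).prod (arcMeasure.prod arcMeasure)) := by
    have h1 := ((hintg 0).mul_prod (hintg 1)).mul_prod ((hintg 2).mul_prod (hintg 3))
    refine (h1.bdd_mul (c := 1) (f := fun q : (UnitCircle × UnitCircle) × UnitCircle × UnitCircle =>
      χ (planeEquiv q.1.1 + planeEquiv q.1.2 + (planeEquiv q.2.1 + planeEquiv q.2.2)))
      (Measurable.aestronglyMeasurable (by fun_prop))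
      (Filter.Eventually.of_forall fun p => hχB _)).congr
      (Filter.Eventually.of_forall fun q => ?_)
    simp only [hΨ_def]; ring
  calc fourConv h E
      = ∫ p, Ψ (MeasurableEquiv.prodAssoc p)
          ∂(((arcMeasure.prod arcMeasure).prod arcMeasure).prod arcMeasure) := by
        rw [fourConv_eq hintg, VectorMeasure.map_apply _ hm4 hE,
          withDensityᵥ_apply hint4 (hm4 hE), ← integral_indicator (hm4 hE)]
        refine integral_congr_ae (Filter.Eventually.of_forall fun p => ?_)
        simp only [hΨ_def, MeasurableEquiv.prodAssoc, MeasurableEquiv.coe_mk,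
          Equiv.prodAssoc_apply]
        rw [← add_assoc, ← map_add, ← map_add, ← map_add, hχE]
        by_cases hp : (p.1.1.1 : Plane) + p.1.1.2 + p.1.2 + p.2 ∈ E
        · rw [Set.indicator_of_mem hp, Set.indicator_of_mem (by exact hp)]
          simp only [Pi.one_apply]; ring
        · rw [Set.indicator_of_notMem hp, Set.indicator_of_notMem (by exact hp)]
          simp
    -- Reassociation from `((0, 1), 2), 3` to `(0, 1), (2, 3)`, so that the two-fold formula applies
    -- to each pair.
    _ = ∫ q, Ψ q ∂((arcMeasure.prod arcMeasure).prod (arcMeasure.prod arcMeasure)) :=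
        (measurePreserving_prodAssoc (arcMeasure.prod arcMeasure) arcMeasure
          arcMeasure).integral_comp' Ψ
    _ = ∫ p, ψ (planeEquiv p.1 + planeEquiv p.2) * (h 0 p.1 * h 1 p.2)
          ∂(arcMeasure.prod arcMeasure) := by
        rw [integral_prod _ hΨ]
        refine integral_congr_ae (Filter.Eventually.of_forall fun p => ?_)
        simp only [hΨ_def]
        rw [integral_mul_const]
        congr 1
        exact integral_arcMeasure_prod (hK 2) (hK 3)
          (φ := fun z => χ (planeEquiv p.1 + planeEquiv p.2 + z)) (by fun_prop)
          (fun z => hχB _)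
    _ = ∫ y, ψ y * f y := integral_arcMeasure_prod (hK 0) (hK 1) hψ hψB
    _ = ∫ x, χ x * quadDensity (fun j => circleExtend (h j)) x :=
        integral_integral_mul_eq hf hk hχ hχB
    _ = ∫ x : Plane, χ (planeEquiv x) *
          quadDensity (fun j => circleExtend (h j)) (planeEquiv x) :=
        (planeEquiv.measurePreserving.integral_comp hem
          (fun x => χ x * quadDensity (fun j => circleExtend (h j)) x)).symm
    _ = _ := by
        rw [withDensityᵥ_apply hI' hE, ← integral_indicator hE]
        refine integral_congr_ae (Filter.Eventually.of_forall fun x => ?_)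
        simp only [hχE]
        by_cases hx : x ∈ E <;> simp [hx]

/-! ### Hölder continuity after multiplication by a power of the norm -/

theorem one_sub_rpow_le {γ t : ℝ} (hγ : 0 < γ) (ht : 0 ≤ t) (ht1 : t ≤ 1) :
    1 - t ^ γ ≤ (1 + γ) * (1 - t) := by
  rcases le_total 1 γ with h | h
  · have := one_add_mul_self_le_rpow_one_add (s := t - 1) (by linarith) h
    rw [add_sub_cancel] at this
    nlinarith
  · have := Real.self_le_rpow_of_le_one ht ht1 h
    nlinarith

/-- Take `‖x'‖ ≤ ‖x‖`. The increment of `G` is multiplied by the smaller weight `‖x'‖ ^ γ`, which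
cancels the worse singularity. The increment of the weight is at most a multiple of `‖x‖ ^ (γ - τ)
‖x - x'‖ ^ τ` and meets `G x`, so `γ - τ - 5τ ≥ 0` is needed. Powers of the norm are bounded because
only norms up to `4` matter. The value of `G` at the origin is irrelevant. -/
theorem norm_rpow_mul_sub_le {G : ℂ → ℂ} {A τ γ : ℝ} (hA : 0 ≤ A) (hτ : 0 < τ) (hτ1 : τ ≤ 1)
    (hγ : 6 * τ ≤ γ) (h0 : ∀ x, 4 ≤ ‖x‖ → G x = 0)
    (h1 : ∀ x, x ≠ 0 → ‖G x‖ ≤ A * ‖x‖ ^ (-(5 * τ)))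
    (h2 : ∀ x x', x ≠ 0 → x' ≠ 0 →
      ‖G x - G x'‖ ≤ A * ‖x - x'‖ ^ τ * (‖x‖ ^ (-(5 * τ)) + ‖x'‖ ^ (-(5 * τ))))
    (x x' : ℂ) :
    ‖((‖x‖ ^ γ : ℝ) : ℂ) * G x - ((‖x'‖ ^ γ : ℝ) : ℂ) * G x'‖ ≤
      (3 + γ) * 4 ^ γ * A * ‖x - x'‖ ^ τ := by
  wlog hle : ‖x'‖ ≤ ‖x‖ generalizing x x'
  · rw [norm_sub_rev, norm_sub_rev x]
    exact this x' x (le_of_not_ge hle)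
  have hγ0 : 0 < γ := by linarith
  have hpow : ∀ {r b : ℝ}, 0 < r → r ≤ 4 → 0 ≤ b → b ≤ γ → r ^ b ≤ 4 ^ γ := by
    intro r b hr hr4 hb hbγ
    exact (Real.rpow_le_rpow hr.le hr4 hb).trans
      (Real.rpow_le_rpow_of_exponent_le (by norm_num) hbγ)
  have hδ : 0 ≤ ‖x - x'‖ ^ τ := by positivity
  have t1 : ‖x'‖ ^ γ * ‖G x - G x'‖ ≤ 2 * 4 ^ γ * A * ‖x - x'‖ ^ τ := by
    rcases eq_or_ne x' 0 with rfl | hx'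
    · rw [norm_zero, Real.zero_rpow hγ0.ne', zero_mul]; positivity
    have hr' : 0 < ‖x'‖ := norm_pos_iff.2 hx'
    have hr : 0 < ‖x‖ := hr'.trans_le hle
    rcases le_total 4 ‖x'‖ with h4 | h4
    · rw [h0 x' h4, h0 x (h4.trans hle), sub_zero, norm_zero, mul_zero]; positivity
    calc _ ≤ ‖x'‖ ^ γ * (A * ‖x - x'‖ ^ τ * (‖x'‖ ^ (-(5 * τ)) + ‖x'‖ ^ (-(5 * τ)))) := by
          gcongr
          refine (h2 x x' (norm_pos_iff.1 hr) hx').trans ?_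
          have := Real.rpow_le_rpow_of_nonpos hr' hle (by linarith : -(5 * τ) ≤ 0)
          exact mul_le_mul_of_nonneg_left (by linarith) (by positivity)
      _ = 2 * (‖x'‖ ^ γ * ‖x'‖ ^ (-(5 * τ))) * A * ‖x - x'‖ ^ τ := by ring
      _ ≤ 2 * 4 ^ γ * A * ‖x - x'‖ ^ τ := by
          gcongr
          rw [← Real.rpow_add hr']
          exact hpow hr' h4 (by linarith) (by linarith)
  have t2 : (‖x‖ ^ γ - ‖x'‖ ^ γ) * ‖G x‖ ≤ (1 + γ) * 4 ^ γ * A * ‖x - x'‖ ^ τ := by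
    rcases eq_or_ne x 0 with rfl | hx
    · have : ‖x'‖ = 0 := le_antisymm (by simpa using hle) (norm_nonneg _)
      rw [this, norm_zero, sub_self, zero_mul]; positivity
    have hr : 0 < ‖x‖ := norm_pos_iff.2 hx
    rcases le_total 4 ‖x‖ with h4 | h4
    · rw [h0 x h4, norm_zero, mul_zero]; positivity
    have hd : (‖x‖ - ‖x'‖) / ‖x‖ ≤ ‖x - x'‖ ^ τ * ‖x‖ ^ (-τ) := by
      have q0 : 0 ≤ (‖x‖ - ‖x'‖) / ‖x‖ := div_nonneg (by linarith) hr.le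
      have q1 : (‖x‖ - ‖x'‖) / ‖x‖ ≤ 1 := by
        rw [div_le_one hr]; linarith [norm_nonneg x']
      calc _ ≤ ((‖x‖ - ‖x'‖) / ‖x‖) ^ τ := Real.self_le_rpow_of_le_one q0 q1 hτ1
        _ ≤ (‖x - x'‖ / ‖x‖) ^ τ := by
            have := norm_sub_norm_le x x'
            gcongr
        _ = _ := by
            rw [Real.div_rpow (norm_nonneg _) hr.le, Real.rpow_neg hr.le, div_eq_mul_inv]
    have hs := one_sub_rpow_le hγ0 (t := ‖x'‖ / ‖x‖) (by positivity) (by rwa [div_le_one hr])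
    have e : ‖x‖ ^ γ - ‖x'‖ ^ γ = ‖x‖ ^ γ * (1 - (‖x'‖ / ‖x‖) ^ γ) := by
      rw [Real.div_rpow (norm_nonneg _) hr.le]
      have := (Real.rpow_pos_of_pos hr γ).ne'
      field_simp
    have e2 : 1 - ‖x'‖ / ‖x‖ = (‖x‖ - ‖x'‖) / ‖x‖ := by field_simp
    rw [e2] at hs
    calc _ ≤ ‖x‖ ^ γ * ((1 + γ) * (‖x - x'‖ ^ τ * ‖x‖ ^ (-τ))) * (A * ‖x‖ ^ (-(5 * τ))) := by
          rw [e]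
          refine mul_le_mul ?_ (h1 x hx) (norm_nonneg _) (by positivity)
          refine mul_le_mul_of_nonneg_left (hs.trans ?_) (by positivity)
          gcongr
      _ = (1 + γ) * (‖x‖ ^ γ * ‖x‖ ^ (-τ) * ‖x‖ ^ (-(5 * τ))) * A * ‖x - x'‖ ^ τ := by ring
      _ ≤ (1 + γ) * 4 ^ γ * A * ‖x - x'‖ ^ τ := by
          gcongr
          rw [← Real.rpow_add hr, ← Real.rpow_add hr]
          exact hpow hr h4 (by linarith) (by linarith)
  have hmono : ‖x'‖ ^ γ ≤ ‖x‖ ^ γ := Real.rpow_le_rpow (norm_nonneg _) hle hγ0.le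
  calc _ = ‖((‖x'‖ ^ γ : ℝ) : ℂ) * (G x - G x') +
        ((‖x‖ ^ γ - ‖x'‖ ^ γ : ℝ) : ℂ) * G x‖ := by congr 1; push_cast; ring
    _ ≤ ‖x'‖ ^ γ * ‖G x - G x'‖ + (‖x‖ ^ γ - ‖x'‖ ^ γ) * ‖G x‖ := by
        refine (norm_add_le _ _).trans_eq ?_
        rw [norm_mul, norm_mul, Complex.norm_real, Complex.norm_real,
          Real.norm_of_nonneg (by positivity), Real.norm_of_nonneg (by linarith)]
    _ ≤ _ := by linarith

theorem lintegral_convWeight_mul_eq_zero (s : ℝ) {x : ℂ} (hx : 4 ≤ ‖x‖) :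
    ∫⁻ y, convWeight s y * convWeight s (x - y) = 0 := by
  refine (lintegral_congr fun y => ?_).trans lintegral_zero
  rcases lt_or_ge ‖y‖ 2 with hy | hy
  · rw [convWeight_eq_zero (z := x - y), mul_zero]
    linarith [norm_sub_norm_le x y]
  · rw [convWeight_eq_zero hy, zero_mul]

section QuadDensity

variable {τ : ℝ} {M : Fin 4 → ℝ} {g : Fin 4 → ℂ → ℂ}

theorem lintegral_enorm_quadDensity_integrand_le (hτ : 0 < τ) (hτ' : 2 * τ ≤ 1)
    (hg : ∀ j, IsCircleLipschitz (M j) (g j)) (x : ℂ) :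
    ∫⁻ y, ‖pairDensity (g 0) (g 1) y * pairDensity (g 2) (g 3) (x - y)‖ₑ ≤
      ENNReal.ofReal (64 * ∏ j, M j) *
        ∫⁻ y, convWeight (1 + 2 * τ) y * convWeight (1 + 2 * τ) (x - y) := by
  have hM := fun j => (hg j).nonneg
  have hw := measurable_convWeight (1 + 2 * τ)
  rw [← lintegral_const_mul _ (by fun_prop)]
  refine lintegral_mono fun y => ?_
  rw [enorm_mul]
  refine (mul_le_mul' (enorm_pairDensity_le hτ hτ' (hg 0) (hg 1) y)
    (enorm_pairDensity_le hτ hτ' (hg 2) (hg 3) (x - y))).trans_eq ?_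
  rw [show 64 * ∏ j, M j = 8 * (M 0 * M 1) * (8 * (M 2 * M 3)) by
    rw [Fin.prod_univ_four]; ring,
    ENNReal.ofReal_mul (p := 8 * (M 0 * M 1)) (by have := hM 0; have := hM 1; positivity)]
  ring

theorem quadDensity_eq_zero (hg : ∀ j, IsCircleLipschitz (M j) (g j)) {x : ℂ} (hx : 4 ≤ ‖x‖) :
    quadDensity g x = 0 := by
  -- Any admissible `τ` would do, since the product of the weights vanishes identically for `4 ≤
  -- ‖x‖`.
  have h := lintegral_enorm_quadDensity_integrand_le (τ := 1 / 2) (by norm_num) (by norm_num) hg x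
  rw [lintegral_convWeight_mul_eq_zero _ hx, mul_zero] at h
  have h2 := (enorm_integral_le_lintegral_enorm _).trans h
  exact enorm_eq_zero.1 (le_antisymm h2 zero_le)

/-- Only the second factor of the convolution depends on `x`, so its increment is estimated against
the size of the first; both are bounded by the same weight. The constant `8000` is `8 * 1000`, from
the size and increment bounds for `pairDensity`. -/
theorem exists_norm_quadDensity_le (hτ : 0 < τ) (hτ' : τ ≤ 1 / 40) :
    ∃ C : ℝ, 0 ≤ C ∧ ∀ (M : Fin 4 → ℝ) (g : Fin 4 → ℂ → ℂ),
      (∀ j, IsCircleLipschitz (M j) (g j)) →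
      (∀ x, x ≠ 0 → ‖quadDensity g x‖ ≤ C * (∏ j, M j) * ‖x‖ ^ (-(5 * τ))) ∧
      ∀ x x', x ≠ 0 → x' ≠ 0 → ‖quadDensity g x - quadDensity g x'‖ ≤
        C * (∏ j, M j) * ‖x - x'‖ ^ τ * (‖x‖ ^ (-(5 * τ)) + ‖x'‖ ^ (-(5 * τ))) := by
  obtain ⟨C, hC, H⟩ := exists_lintegral_convWeight_mul_le hτ hτ'
  have hτ2 : 2 * τ ≤ 1 := by linarith
  have H' : ∀ x : ℂ, x ≠ 0 →
      ∫⁻ y, convWeight (1 + 2 * τ) y * convWeight (1 + 2 * τ) (x - y) ≤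
        ENNReal.ofReal (C.toReal * ‖x‖ ^ (-(5 * τ))) := by
    intro x hx
    refine (H x hx).trans_eq ?_
    have hr : 0 < ‖x‖ := norm_pos_iff.2 hx
    rw [ENNReal.ofReal_mul ENNReal.toReal_nonneg, ENNReal.ofReal_toReal hC,
      ← ENNReal.ofReal_rpow_of_pos hr, ENNReal.rpow_neg, ofReal_norm]
  refine ⟨8000 * C.toReal, by positivity, fun M g hg => ?_⟩
  have hM := fun j => (hg j).nonneg
  have hP : 0 ≤ ∏ j, M j := Finset.prod_nonneg fun j _ => hM j
  have hw := measurable_convWeight (1 + 2 * τ)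
  have m1 := (hg 0).measurable_pairDensity (hg 1)
  have m2 := (hg 2).measurable_pairDensity (hg 3)
  have hbound := lintegral_enorm_quadDensity_integrand_le hτ hτ2 hg
  have hint : ∀ x, x ≠ 0 →
      Integrable fun y => pairDensity (g 0) (g 1) y * pairDensity (g 2) (g 3) (x - y) := by
    intro x hx
    refine ⟨Measurable.aestronglyMeasurable (by fun_prop), ?_⟩
    refine (hbound x).trans_lt (ENNReal.mul_lt_top ENNReal.ofReal_lt_top ?_)
    exact (H' x hx).trans_lt ENNReal.ofReal_lt_top
  constructor
  · intro x hx
    have h1 := (enorm_integral_le_lintegral_enorm _).trans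
      ((hbound x).trans (mul_le_mul_right (H' x hx) _))
    rw [← ENNReal.ofReal_mul (by positivity), ← ofReal_norm,
      ENNReal.ofReal_le_ofReal_iff (by positivity)] at h1
    refine h1.trans ?_
    calc _ = 64 * (C.toReal * (∏ j, M j) * ‖x‖ ^ (-(5 * τ))) := by ring
      _ ≤ 8000 * (C.toReal * (∏ j, M j) * ‖x‖ ^ (-(5 * τ))) := by gcongr; norm_num
      _ = _ := by ring
  · intro x x' hx hx'
    have e : quadDensity g x - quadDensity g x' = ∫ y, pairDensity (g 0) (g 1) y *
        (pairDensity (g 2) (g 3) (x - y) - pairDensity (g 2) (g 3) (x' - y)) := by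
      rw [quadDensity, quadDensity, ← integral_sub (hint x hx) (hint x' hx')]
      simp only [mul_sub]
    set A := 8 * (M 0 * M 1) * (1000 * (M 2 * M 3) * ‖x - x'‖ ^ τ) with hA_def
    have h01 : 0 ≤ 8 * (M 0 * M 1) := by have := hM 0; have := hM 1; positivity
    have h23 : 0 ≤ 1000 * (M 2 * M 3) * ‖x - x'‖ ^ τ := by
      have := hM 2; have := hM 3; positivity
    have h1 : ‖quadDensity g x - quadDensity g x'‖ₑ ≤
        ENNReal.ofReal A * (ENNReal.ofReal (C.toReal * ‖x‖ ^ (-(5 * τ))) +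
          ENNReal.ofReal (C.toReal * ‖x'‖ ^ (-(5 * τ)))) := by
      calc _ ≤ ∫⁻ y, ‖pairDensity (g 0) (g 1) y *
            (pairDensity (g 2) (g 3) (x - y) - pairDensity (g 2) (g 3) (x' - y))‖ₑ := by
            rw [e]; exact enorm_integral_le_lintegral_enorm _
        _ ≤ ∫⁻ y, ENNReal.ofReal A * (convWeight (1 + 2 * τ) y * convWeight (1 + 2 * τ) (x - y) +
            convWeight (1 + 2 * τ) y * convWeight (1 + 2 * τ) (x' - y)) := by
            refine lintegral_mono fun y => ?_
            rw [enorm_mul]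
            refine (mul_le_mul' (enorm_pairDensity_le hτ hτ2 (hg 0) (hg 1) y)
              (enorm_pairDensity_sub_le hτ hτ2 (hg 2) (hg 3) (x - y) (x' - y))).trans_eq ?_
            rw [sub_sub_sub_cancel_right, hA_def, ENNReal.ofReal_mul h01]
            ring
        _ ≤ _ := by
            rw [lintegral_const_mul _ (by fun_prop), lintegral_add_left (by fun_prop)]
            gcongr
            exacts [H' x hx, H' x' hx']
    rw [← ENNReal.ofReal_add (by positivity) (by positivity),
      ← ENNReal.ofReal_mul (mul_nonneg h01 h23), ← ofReal_norm,
      ENNReal.ofReal_le_ofReal_iff (mul_nonneg (mul_nonneg h01 h23) (by positivity))] at h1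
    refine h1.trans_eq ?_
    rw [Fin.prod_univ_four]
    ring

end QuadDensity

end

theorem mainTheorem4 (γ : ℝ) (hγ : 0 < γ) :
    ∃ τ C₀ : ℝ, 0 < τ ∧ τ < 1 ∧
      ∀ h : Fin 4 → UnitCircle → ℂ, (∀ j, ∃ K : NNReal, LipschitzWith K (h j)) →
        ∃ G : Plane → ℂ, Integrable G volume ∧
          fourConv h = (volume : Measure Plane).withDensityᵥ G ∧
          ∀ x x' : Plane,
            ‖((‖x‖ ^ γ : ℝ) : ℂ) * G x - ((‖x'‖ ^ γ : ℝ) : ℂ) * G x'‖ ≤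
              C₀ * (∏ j, lipNorm (h j)) * ‖x - x'‖ ^ τ := by
  -- The bound `1 / 40` leaves room in all the singular integrals; `γ / 6` lets the weight absorb
  -- the loss `5τ` and a further `τ`.
  set τ := min (1 / 40) (γ / 6) with hτ_def
  have hτ : 0 < τ := lt_min (by norm_num) (by linarith)
  have hτ' : τ ≤ 1 / 40 := min_le_left _ _
  have hτγ : 6 * τ ≤ γ := by linarith [min_le_right (1 / 40) (γ / 6)]
  obtain ⟨C, hC, H⟩ := exists_norm_quadDensity_le hτ hτ'
  refine ⟨τ, (3 + γ) * 4 ^ γ * C, hτ, by linarith, fun h hh => ?_⟩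
  have hd := fourConv_eq_withDensity hh
  choose K hK using hh
  have hg := fun j => isCircleLipschitz_circleExtend (hK j)
  have hP : 0 ≤ ∏ j, lipNorm (h j) := Finset.prod_nonneg fun j _ => lipNorm_nonneg _
  refine ⟨fun x => quadDensity (fun j => circleExtend (h j)) (planeEquiv x),
    (planeEquiv.measurePreserving.integrable_comp_emb
      planeEquiv.toHomeomorph.measurableEmbedding).2 (integrable_quadDensity hg), hd,
    fun x x' => ?_⟩
  have := norm_rpow_mul_sub_le (mul_nonneg hC hP) hτ (by linarith) hτγ
    (fun x hx => quadDensity_eq_zero hg hx) (H _ _ hg).1 (H _ _ hg).2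
    (planeEquiv x) (planeEquiv x')
  rw [← map_sub, planeEquiv.norm_map, planeEquiv.norm_map, planeEquiv.norm_map] at this
  refine this.trans_eq ?_
  ring
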